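/- Let $q\in(0,1)$, and let $\zeta$ be a non-zero $q$-normal operator on a complex Hilbert space $\mathcal H$; that is, $\zeta$ is a densely defined closed linear operator on $\mathcal H$ with $\zeta\neq 0$ and $\zeta\zeta^*=q^2\zeta^*\zeta$, where both products are taken on their natural domains and the equality includes equality of domains. Then there exist a non-zero Hilbert space $\mathcal H_0$, a bounded self-adjoint operator $A$ on $\mathcal H_0$ with $\mathrm{spec}(A)\subset[q,1]$ such that $q$ is not an eigenvalue of $A$, and a unitary operator $$U:\mathcal H\to\ker(\zeta)\oplus\bigoplus_{n\in\mathbb Z}\mathcal H_n,\qquad \mathcal H_n=\mathcal H_0 \text{ for all } n\in\mathbb Z,$$ (Hilbert space direct sum) with $Uk=(k,0)$ for $k\in\ker(\zeta)$, such that the following holds. For $h\in\mathcal H_0$ and $n\in\mathbb Z$ let $h_n$ denote the vector with $h$ in the $n$-th summand $\mathcal H_n$ and $0$ elsewhere. Then $U^{-1}h_n\in\mathrm{dom}(\zeta)$ and $$U\zeta U^{-1}h_n=q^n (Ah)_{n-1}\qquad\text{for all } h\in\mathcal H_0,\ n\in\mathbb Z .$$ Moreover, these formulas determine $\zeta$: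 a vector $x\in\mathcal H$ with $Ux=(k,(x_n)_{n\in\mathbb Z})$ belongs to $\mathrm{dom}(\zeta)$ if and only if $\sum_{n\in\mathbb Z}\|q^nAx_n\|^2<\infty$, and in this case $U\zeta x=(0,(q^{n+1}Ax_{n+1})_{n\in\mathbb Z})$. -/

import Mathlib

noncomputable section

namespace QNormal

universe u v w

variable {E : Type u} {F : Type v} {G : Type w}
  [AddCommGroup E] [Module ℂ E] [AddCommGroup F] [Module ℂ F] [AddCommGroup G] [Module ℂ G]

/-- The product `S T` of two unbounded operators, on its natural domain
`{x ∈ dom T : T x ∈ dom S}`. -/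
def mul (S : F →ₗ.[ℂ] G) (T : E →ₗ.[ℂ] F) : E →ₗ.[ℂ] G where
  domain := (S.domain.comap T.toFun).map T.domain.subtype
  toFun :=
    { toFun := fun x =>
        S ⟨T ⟨x, by obtain ⟨x, y, _, rfl⟩ := x; exact y.2⟩,
          by obtain ⟨x, y, hy, rfl⟩ := x; exact hy⟩
      map_add' := fun x y => by
        rw [← LinearPMap.map_add]
        exact congrArg S (Subtype.ext (LinearPMap.map_add T ⟨_, _⟩ ⟨_, _⟩))
      map_smul' := fun c x => by
        rw [RingHom.id_apply, ← LinearPMap.map_smul]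
        exact congrArg S (Subtype.ext (LinearPMap.map_smul T c ⟨_, _⟩)) }

/-- The kernel of an unbounded operator, as a subspace of the ambient space. -/
def ker (T : E →ₗ.[ℂ] F) : Submodule ℂ E :=
  (LinearMap.ker T.toFun).map T.domain.subtype

/-- `ζ` is `q`-normal: densely defined, closed, and `ζ ζ* = q² ζ* ζ` as an equality of unbounded
operators (equal natural domains, equal values). -/
structure IsQNormal {H : Type u} [NormedAddCommGroup H] [InnerProductSpace ℂ H] [CompleteSpace H]
    (q : ℝ) (ζ : H →ₗ.[ℂ] H) : Prop where
  dense_domain : Dense (ζ.domain : Set H)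
  isClosed : ζ.IsClosed
  comm : mul ζ ζ.adjoint = ((q : ℂ) ^ 2) • mul ζ.adjoint ζ

section Model

variable (K : Type u) [NormedAddCommGroup K] [InnerProductSpace ℂ K]
  (H₀ : Type u) [NormedAddCommGroup H₀] [InnerProductSpace ℂ H₀]

/-- The Hilbert space direct sum `K ⊕ ⨁_{n ∈ ℤ} H_n` with `H_n = H₀` for every `n`. -/
abbrev Space : Type u := WithLp 2 (K × lp (fun _ : ℤ => H₀) 2)

variable {H₀}

/-- The vector `h_n` with `h` in the `n`-th summand `H_n` and `0` elsewhere. -/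
def single (n : ℤ) (h : H₀) : Space K H₀ :=
  WithLp.toLp 2 (0, lp.single 2 n h)

variable {K}

/-- The components `m ↦ q^(m+1) A x_{m+1}` of the image of a vector `(k, (x_n)_n)` under the
operator that vanishes on `K` and sends `h_n` to `q^n (A h)_{n-1}`. -/
def shift (q : ℝ) (A : H₀ →L[ℂ] H₀) (x : Space K H₀) (m : ℤ) : H₀ :=
  ((q : ℂ) ^ (m + 1)) • A (x.snd (m + 1))

end Model

/-- The operator on `K ⊕ ⨁_{n ∈ ℤ} H₀` that vanishes on `K` and sends `h_n` to `q^n (A h)_{n-1}`,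
on its maximal domain, the vectors whose formal image is square summable. -/
def model (K : Type u) [NormedAddCommGroup K] [InnerProductSpace ℂ K]
    {H₀ : Type u} [NormedAddCommGroup H₀] [InnerProductSpace ℂ H₀]
    (q : ℝ) (A : H₀ →L[ℂ] H₀) : Space K H₀ →ₗ.[ℂ] Space K H₀ where
  domain :=
    { carrier := {x | Memℓp (shift q A x) 2}
      zero_mem' := by
        have : shift q A (0 : Space K H₀) = 0 := by ext m; simp [shift]
        simpa [this] using zero_memℓp
      add_mem' := fun {x y} hx hy => by
        have : shift q A (x + y) = shift q A x + shift q A y := by ext m; simp [shift]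
        simpa [this] using hx.add hy
      smul_mem' := fun c x hx => by
        have : shift q A (c • x) = c • shift q A x := by
          ext m; simp [shift, smul_comm c]
        simpa [this] using hx.const_smul c }
  toFun :=
    { toFun := fun x => WithLp.toLp 2 (0, ⟨shift q A x.1, x.2⟩)
      map_add' := fun x y => by
        refine WithLp.ofLp_injective 2 (Prod.ext (by simp) (lp.ext (funext fun m => ?_)))
        simp [shift]
        rfl
      map_smul' := fun c x => by
        refine WithLp.ofLp_injective 2 (Prod.ext (by simp) (lp.ext (funext fun m => ?_)))
        simp [shift, smul_comm c] }

end QNormal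

end

open scoped InnerProductSpace ComplexConjugate

namespace QNormal

/-! ### The projection onto the graph of a closed operator. -/

section GraphProjection

variable {H : Type*} [NormedAddCommGroup H] [InnerProductSpace ℂ H] [CompleteSpace H]

/-! Write the polar decomposition of `ζ` as `W|ζ|`, with the partial isometry extended by the
identity on `ker ζ = ker ζ*`, so that `W` is unitary. Then `q`-normality says that `W |ζ|² W⁻¹ = q²
|ζ|²`, so `W⁻¹` multiplies spectral values of `|ζ|` by `q`. Off the kernel, the spectral subspaces
of `|ζ|` for the intervals `(q^(n+1), q^n]` are therefore the translates `W^(-n) H₀` of the one for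
`(q, 1]`, and they exhaust `(ker ζ)ᗮ`. Take `A = |ζ|` on `H₀` and let `h_n` correspond to `W^(-n)
h`; then `ζ h_n = W |ζ| W^(-n) h = q^n W^(-(n-1)) A h`.

All of this is carried out with bounded operators. The projection onto the graph of `ζ` supplies `R
= (1 + |ζ|²)⁻¹` and `B = ζ R`, and `|ζ|` is represented by the pairs `(R x, sqrtMul R x)`, where
`sqrtMul R = |ζ| R`. The relation between `ζζ*` and `ζ*ζ` becomes `W R W⁻¹ = moebius (q ^ 2) R`
(`S_eq_cfc`, `exists_polar`). Only continuous functional calculus is used: the subspace `|ζ| ≤ 1`,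
that is `R ≥ 1/2`, is the kernel of the negative part of `R - 1/2`, and `W⁻¹` maps it into itself.
The complement of its image under `W⁻¹` is `H₀`.

A vector orthogonal to every translate of `H₀` splits into a part on which `|ζ|` is arbitrarily
small and a part on which it is arbitrarily large; the first lies in `ker ζ` and the second is zero
(`sqrtMul_eq_zero_of_forall_inner`). Finally, the formulas on the vectors `h_n` determine `ζ`:
closedness puts the maximal domain inside `dom ζ`, and pairing with `ζ* h_m` gives the converse. -/

/-- The four blocks of the orthogonal projection onto the graph of `ζ`:
`R = (1 + ζ*ζ)⁻¹`, `S = (1 + ζζ*)⁻¹`, `B = ζ R` and `B' = ζ* S`. -/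
structure IsGraphProjection (ζ : H →ₗ.[ℂ] H) (R S B B' : H →L[ℂ] H) : Prop where
  R_symm : ∀ x y, ⟪R x, y⟫_ℂ = ⟪x, R y⟫_ℂ
  S_symm : ∀ x y, ⟪S x, y⟫_ℂ = ⟪x, S y⟫_ℂ
  B_adj : ∀ x y, ⟪B x, y⟫_ℂ = ⟪x, B' y⟫_ℂ
  R_mem : ∀ x, (R x, B x) ∈ ζ.graph
  B_mem : ∀ x, (B x, x - R x) ∈ ζ.adjoint.graph
  B'_mem : ∀ x, (B' x, x - S x) ∈ ζ.graph
  S_mem : ∀ x, (S x, B' x) ∈ ζ.adjoint.graph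

theorem inner_eq_of_mem_graph_adjoint {ζ : H →ₗ.[ℂ] H} (hd : Dense (ζ.domain : Set H))
    {x y u v : H} (h : (x, y) ∈ ζ.graph) (h' : (u, v) ∈ ζ.adjoint.graph) :
    ⟪y, u⟫_ℂ = ⟪x, v⟫_ℂ := by
  rw [LinearPMap.adjoint_graph_eq_graph_adjoint hd, Submodule.mem_adjoint_iff] at h'
  exact sub_eq_zero.1 (h' x y h)

theorem mem_graph_adjoint {ζ : H →ₗ.[ℂ] H} (hd : Dense (ζ.domain : Set H)) {u v : H}
    (h : ∀ x y, (x, y) ∈ ζ.graph → ⟪y, u⟫_ℂ = ⟪x, v⟫_ℂ) : (u, v) ∈ ζ.adjoint.graph := by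
  rw [LinearPMap.adjoint_graph_eq_graph_adjoint hd, Submodule.mem_adjoint_iff]
  exact fun x y hxy => sub_eq_zero.2 (h x y hxy)

/-- The projection sends `(x, 0)` to `(R x, B x)` and `(0, x)` to `(B' x, x - S x)`. The remainders
are orthogonal to the graph of `ζ`, which is exactly a membership in the graph of `ζ*`. -/
theorem exists_isGraphProjection {ζ : H →ₗ.[ℂ] H} (hd : Dense (ζ.domain : Set H))
    (hc : ζ.IsClosed) : ∃ R S B B' : H →L[ℂ] H, IsGraphProjection ζ R S B B' := by
  let e : WithLp 2 (H × H) ≃L[ℂ] H × H := WithLp.prodContinuousLinearEquiv 2 ℂ H H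
  let Γ : Submodule ℂ (WithLp 2 (H × H)) := ζ.graph.comap e.toLinearEquiv.toLinearMap
  have hΓ : IsClosed (Γ : Set (WithLp 2 (H × H))) := hc.preimage e.continuous
  have : CompleteSpace Γ := hΓ.completeSpace_coe
  let P : WithLp 2 (H × H) →L[ℂ] WithLp 2 (H × H) := Γ.starProjection
  have hP : ∀ z w, ⟪P z, w⟫_ℂ = ⟪z, P w⟫_ℂ := Γ.inner_starProjection_left_eq_right
  have hPm : ∀ z, (e (P z)) ∈ ζ.graph := fun z => Γ.starProjection_apply_mem z
  have hPo : ∀ z, ∀ x y, (x, y) ∈ ζ.graph →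
      ⟪x, (e z).1 - (e (P z)).1⟫_ℂ + ⟪y, (e z).2 - (e (P z)).2⟫_ℂ = 0 := by
    intro z x y hxy
    have h1 := Γ.sub_starProjection_mem_orthogonal z
    rw [Submodule.mem_orthogonal] at h1
    exact h1 (e.symm (x, y)) (by simpa [Γ] using hxy)
  let fst : WithLp 2 (H × H) →L[ℂ] H := (ContinuousLinearMap.fst ℂ H H) ∘L (e : _ →L[ℂ] _)
  let snd : WithLp 2 (H × H) →L[ℂ] H := (ContinuousLinearMap.snd ℂ H H) ∘L (e : _ →L[ℂ] _)
  let i₁ : H →L[ℂ] WithLp 2 (H × H) := (e.symm : _ →L[ℂ] _) ∘L (ContinuousLinearMap.inl ℂ H H)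
  let i₂ : H →L[ℂ] WithLp 2 (H × H) := (e.symm : _ →L[ℂ] _) ∘L (ContinuousLinearMap.inr ℂ H H)
  have a1 : ∀ x z, ⟪i₁ x, z⟫_ℂ = ⟪x, fst z⟫_ℂ := fun x z => by
    simp [i₁, fst, e, WithLp.prod_inner_apply]
  have a2 : ∀ x z, ⟪i₂ x, z⟫_ℂ = ⟪x, snd z⟫_ℂ := fun x z => by
    simp [i₂, snd, e, WithLp.prod_inner_apply]
  have b1 : ∀ x z, ⟪z, i₁ x⟫_ℂ = ⟪fst z, x⟫_ℂ := fun x z => by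
    simp [i₁, fst, e, WithLp.prod_inner_apply]
  have b2 : ∀ x z, ⟪z, i₂ x⟫_ℂ = ⟪snd z, x⟫_ℂ := fun x z => by
    simp [i₂, snd, e, WithLp.prod_inner_apply]
  have e1 : ∀ x, e (i₁ x) = (x, 0) := fun x => by simp [i₁]
  have e2 : ∀ x, e (i₂ x) = (0, x) := fun x => by simp [i₂]
  refine ⟨fst ∘L P ∘L i₁, 1 - snd ∘L P ∘L i₂, snd ∘L P ∘L i₁, fst ∘L P ∘L i₂,
    ?_, ?_, ?_, ?_, ?_, ?_, ?_⟩
  · intro x y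
    change ⟪fst (P (i₁ x)), y⟫_ℂ = ⟪x, fst (P (i₁ y))⟫_ℂ
    rw [← a1, ← b1, hP]
  · intro x y
    change ⟪x - snd (P (i₂ x)), y⟫_ℂ = ⟪x, y - snd (P (i₂ y))⟫_ℂ
    rw [inner_sub_left, inner_sub_right, ← a2, ← b2, hP]
  · intro x y
    change ⟪snd (P (i₁ x)), y⟫_ℂ = ⟪x, fst (P (i₂ y))⟫_ℂ
    rw [← a1, ← b2, hP]
  · exact fun x => hPm (i₁ x)
  · intro x
    refine mem_graph_adjoint hd fun u v huv => ?_
    have := hPo (i₁ x) u v huv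
    rw [e1] at this
    simp only [zero_sub, inner_neg_right] at this
    exact (add_neg_eq_zero.1 this).symm
  · intro x
    have := hPm (i₂ x)
    change (fst (P (i₂ x)), x - (x - snd (P (i₂ x)))) ∈ _
    rwa [sub_sub_cancel]
  · intro x
    refine mem_graph_adjoint hd fun u v huv => ?_
    have := hPo (i₂ x) u v huv
    rw [e2] at this
    simp only [zero_sub, inner_neg_right] at this
    exact neg_add_eq_zero.1 this |>.symm

end GraphProjection

/-! ### Resolvent identities forced by `q`-normality. -/

section QRelation

variable {H : Type*} [NormedAddCommGroup H] [InnerProductSpace ℂ H] [CompleteSpace H]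
  {q : ℝ} {ζ : H →ₗ.[ℂ] H} {R S B B' : H →L[ℂ] H}

theorem mem_graph_mul {E F G : Type*} [AddCommGroup E] [Module ℂ E] [AddCommGroup F] [Module ℂ F]
    [AddCommGroup G] [Module ℂ G] {S : F →ₗ.[ℂ] G} {T : E →ₗ.[ℂ] F} {x : E} {z : G} :
    (x, z) ∈ (mul S T).graph ↔ ∃ y, (x, y) ∈ T.graph ∧ (y, z) ∈ S.graph := by
  constructor
  · intro h
    obtain ⟨⟨_, w, hw, rfl⟩, rfl, rfl⟩ := (mul S T).mem_graph_iff.1 h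
    exact ⟨T w, T.mem_graph w, S.mem_graph ⟨T w, hw⟩⟩
  · rintro ⟨y, hxy, hyz⟩
    obtain ⟨w, rfl, rfl⟩ := T.mem_graph_iff.1 hxy
    obtain ⟨v, hv, rfl⟩ := S.mem_graph_iff.1 hyz
    have hw : T w ∈ S.domain := by
      have := v.2
      rwa [hv] at this
    obtain rfl : v = ⟨T w, hw⟩ := Subtype.ext hv
    exact (mul S T).mem_graph ⟨w, w, hw, rfl⟩

theorem IsQNormal.exists_mem_graph (hζ : IsQNormal q ζ) {x y z : H} (h : (x, y) ∈ ζ.graph)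
    (h' : (y, z) ∈ ζ.adjoint.graph) :
    ∃ w, (x, w) ∈ ζ.adjoint.graph ∧ (w, ((q : ℂ) ^ 2) • z) ∈ ζ.graph := by
  rw [← mem_graph_mul, hζ.comm]
  obtain ⟨u, hu, hz⟩ := LinearPMap.mem_graph_iff _ |>.1 (mem_graph_mul.2 ⟨y, h, h'⟩)
  refine LinearPMap.mem_graph_iff _ |>.2 ⟨u, hu, ?_⟩
  rw [LinearPMap.smul_apply, hz]

theorem IsQNormal.exists_mem_graph' (hq : q ≠ 0) (hζ : IsQNormal q ζ) {x y z : H}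
    (h : (x, y) ∈ ζ.adjoint.graph) (h' : (y, z) ∈ ζ.graph) :
    ∃ w, (x, w) ∈ ζ.graph ∧ (w, ((q : ℂ) ^ 2)⁻¹ • z) ∈ ζ.adjoint.graph := by
  have h1 := mem_graph_mul.2 ⟨y, h, h'⟩
  rw [hζ.comm] at h1
  obtain ⟨u, hu, hz⟩ := LinearPMap.mem_graph_iff _ |>.1 h1
  rw [LinearPMap.smul_apply] at hz
  refine mem_graph_mul.1 (LinearPMap.mem_graph_iff _ |>.2 ⟨u, hu, ?_⟩)
  have h0 : (q : ℂ) ^ 2 ≠ 0 := by simpa using hq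
  exact (inv_smul_smul₀ h0 _).symm.trans (congrArg _ hz)

namespace IsGraphProjection

/-- Injectivity of `1 + ζζ*`: the difference `u` of two solutions has `ζζ* u = -u`, so `‖ζ* u‖² =
-‖u‖²`. -/
theorem eq_S (hP : IsGraphProjection ζ R S B B') (hd : Dense (ζ.domain : Set H)) {x y z : H}
    (h : (x, y) ∈ ζ.adjoint.graph) (h' : (y, z) ∈ ζ.graph) : S (x + z) = x := by
  have h1 := ζ.adjoint.graph.sub_mem h (hP.S_mem (x + z))
  have h2 := ζ.graph.sub_mem h' (hP.B'_mem (x + z))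
  have h3 := inner_eq_of_mem_graph_adjoint hd h2 h1
  set u := x - S (x + z) with hu
  have h4 : z - (x + z - S (x + z)) = -u := by rw [hu]; abel
  change ⟪z - (x + z - S (x + z)), u⟫_ℂ = ⟪y - B' (x + z), y - B' (x + z)⟫_ℂ at h3
  rw [h4, inner_neg_left, inner_self_eq_norm_sq_to_K, inner_self_eq_norm_sq_to_K] at h3
  have h5 : -(‖u‖ ^ 2) = ‖y - B' (x + z)‖ ^ 2 := by exact_mod_cast h3
  have h6 : ‖u‖ ^ 2 = 0 := by nlinarith [sq_nonneg ‖u‖, sq_nonneg ‖y - B' (x + z)‖]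
  have : u = 0 := by simpa using h6
  exact (sub_eq_zero.1 this).symm

theorem eq_R (hP : IsGraphProjection ζ R S B B') (hd : Dense (ζ.domain : Set H)) {x y z : H}
    (h : (x, y) ∈ ζ.graph) (h' : (y, z) ∈ ζ.adjoint.graph) : R (x + z) = x := by
  have h1 := ζ.graph.sub_mem h (hP.R_mem (x + z))
  have h2 := ζ.adjoint.graph.sub_mem h' (hP.B_mem (x + z))
  have h3 := inner_eq_of_mem_graph_adjoint hd h1 h2
  set u := x - R (x + z) with hu
  have h4 : z - (x + z - R (x + z)) = -u := by rw [hu]; abel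
  change ⟪y - B (x + z), y - B (x + z)⟫_ℂ = ⟪u, z - (x + z - R (x + z))⟫_ℂ at h3
  rw [h4, inner_neg_right, inner_self_eq_norm_sq_to_K, inner_self_eq_norm_sq_to_K] at h3
  have h5 : ‖y - B (x + z)‖ ^ 2 = -(‖u‖ ^ 2) := by exact_mod_cast h3
  have h6 : ‖u‖ ^ 2 = 0 := by nlinarith [sq_nonneg ‖u‖, sq_nonneg ‖y - B (x + z)‖]
  have : u = 0 := by simpa using h6
  exact (sub_eq_zero.1 this).symm

/-- Since `ζ*ζ R x = x - R x`, `q`-normality gives `(1 + ζζ*) R x = R x + q² (x - R x)`; apply `S`.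
-/
theorem S_mul (hP : IsGraphProjection ζ R S B B') (hζ : IsQNormal q ζ) :
    S * ((q : ℂ) ^ 2 • 1 + (1 - (q : ℂ) ^ 2) • R) = R := by
  ext x
  obtain ⟨w, hw, hw'⟩ := hζ.exists_mem_graph (hP.R_mem x) (hP.B_mem x)
  have := hP.eq_S hζ.dense_domain hw hw'
  have e : ((q : ℂ) ^ 2 • 1 + (1 - (q : ℂ) ^ 2) • R : H →L[ℂ] H) x = R x + (q : ℂ) ^ 2 • (x - R x) := by
    change (q : ℂ) ^ 2 • x + (1 - (q : ℂ) ^ 2) • R x = _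
    module
  rw [mul_apply_eq_comp, e, this]

theorem B_mul_R (hP : IsGraphProjection ζ R S B B') (hd : Dense (ζ.domain : Set H)) :
    B * R = S * B := by
  ext x
  have := hP.eq_S hd (hP.B_mem (R x)) (ζ.graph.sub_mem (hP.R_mem x) (hP.R_mem (R x)))
  simp at this
  simp [this]

theorem norm_B_sq (hP : IsGraphProjection ζ R S B B') (hd : Dense (ζ.domain : Set H)) (x : H) :
    ⟪B x, B x⟫_ℂ = ⟪R x, x - R x⟫_ℂ :=
  inner_eq_of_mem_graph_adjoint hd (hP.R_mem x) (hP.B_mem x)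

theorem R_nonneg (hP : IsGraphProjection ζ R S B B') (hd : Dense (ζ.domain : Set H)) : 0 ≤ R := by
  rw [ContinuousLinearMap.nonneg_iff_isPositive, ContinuousLinearMap.isPositive_def]
  refine ⟨hP.R_symm, fun x => ?_⟩
  have h := hP.norm_B_sq hd x
  rw [inner_sub_right, eq_sub_iff_add_eq] at h
  rw [ContinuousLinearMap.reApplyInnerSelf_apply, ← h, map_add]
  exact add_nonneg inner_self_nonneg inner_self_nonneg

theorem R_le_one (hP : IsGraphProjection ζ R S B B') (hd : Dense (ζ.domain : Set H)) : R ≤ 1 := by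
  rw [ContinuousLinearMap.le_def, ContinuousLinearMap.isPositive_def]
  refine ⟨fun x y => by
    simp [inner_sub_left, inner_sub_right, hP.R_symm], fun x => ?_⟩
  have h := hP.norm_B_sq hd x
  have h2 : ⟪x - R x, x⟫_ℂ = ⟪x - R x, x - R x⟫_ℂ + conj ⟪B x, B x⟫_ℂ := by
    rw [h, inner_conj_symm, ← inner_add_right, sub_add_cancel]
  rw [ContinuousLinearMap.reApplyInnerSelf_apply]
  change 0 ≤ RCLike.re ⟪x - R x, x⟫_ℂ
  rw [h2, map_add, inner_conj_symm]
  exact add_nonneg inner_self_nonneg inner_self_nonneg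

theorem R_injective (hP : IsGraphProjection ζ R S B B') {x : H} (hx : R x = 0) : x = 0 := by
  have h1 := hP.R_mem x
  have hB : B x = 0 := ζ.graph_fst_eq_zero_snd h1 hx
  have := ζ.adjoint.graph_fst_eq_zero_snd (hP.B_mem x) hB
  rwa [hx, sub_zero] at this

end IsGraphProjection

end QRelation

/-! ### The common kernel of `ζ` and `ζ*`. -/

section Kernel

variable {H : Type*} [NormedAddCommGroup H] [InnerProductSpace ℂ H] [CompleteSpace H]
  {q : ℝ} {ζ : H →ₗ.[ℂ] H} {R S B B' : H →L[ℂ] H}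

theorem mem_ker_iff {E F : Type*} [AddCommGroup E] [Module ℂ E] [AddCommGroup F] [Module ℂ F]
    {T : E →ₗ.[ℂ] F} {x : E} : x ∈ ker T ↔ (x, 0) ∈ T.graph := by
  constructor
  · rintro ⟨y, hy, rfl⟩
    have : T y = 0 := hy
    exact T.mem_graph_iff.2 ⟨y, rfl, this⟩
  · intro h
    obtain ⟨y, rfl, hy⟩ := T.mem_graph_iff.1 h
    exact ⟨y, hy, rfl⟩

/-- If `ζ x = 0` then `ζζ* x = q² ζ*ζ x = 0`, and pairing with `x` gives `‖ζ* x‖² = 0`; the converse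
is symmetric after dividing by `q²`. -/
theorem IsQNormal.mem_ker_iff_adjoint (hζ : IsQNormal q ζ) (hq : q ≠ 0) {x : H} :
    x ∈ ker ζ ↔ (x, 0) ∈ ζ.adjoint.graph := by
  have hd := hζ.dense_domain
  rw [mem_ker_iff]
  constructor
  · intro h
    obtain ⟨w, hw, hw'⟩ := hζ.exists_mem_graph h ζ.adjoint.graph.zero_mem
    have := inner_eq_of_mem_graph_adjoint hd hw' hw
    rw [smul_zero, inner_zero_left] at this
    rwa [inner_self_eq_zero.1 this.symm] at hw
  · intro h
    obtain ⟨w, hw, hw'⟩ := hζ.exists_mem_graph' hq h ζ.graph.zero_mem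
    have := inner_eq_of_mem_graph_adjoint hd hw hw'
    rw [smul_zero, inner_zero_right] at this
    rwa [inner_self_eq_zero.1 this] at hw

namespace IsGraphProjection

theorem mem_ker_iff_B (hP : IsGraphProjection ζ R S B B') (hd : Dense (ζ.domain : Set H)) {x : H} :
    x ∈ ker ζ ↔ B x = 0 := by
  rw [mem_ker_iff]
  constructor
  · intro h
    have := hP.eq_R hd h ζ.adjoint.graph.zero_mem
    rw [add_zero] at this
    have h1 := hP.R_mem x
    rw [this] at h1
    exact ζ.mem_graph_snd_inj h1 h rfl
  · intro h
    have h2 := ζ.adjoint.graph_fst_eq_zero_snd (hP.B_mem x) h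
    have h1 := hP.R_mem x
    rwa [h, ← sub_eq_zero.1 h2] at h1

theorem mem_ker_iff_R (hP : IsGraphProjection ζ R S B B') (hd : Dense (ζ.domain : Set H)) {x : H} :
    x ∈ ker ζ ↔ R x = x := by
  constructor
  · intro h
    have := hP.eq_R hd (mem_ker_iff.1 h) ζ.adjoint.graph.zero_mem
    rwa [add_zero] at this
  · intro h
    rw [hP.mem_ker_iff_B hd]
    have := hP.norm_B_sq hd x
    rw [h, sub_self, inner_zero_right] at this
    exact inner_self_eq_zero.1 this

theorem mem_ker_iff_S (hP : IsGraphProjection ζ R S B B') (hq : q ≠ 0) (hζ : IsQNormal q ζ)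
    {x : H} : x ∈ ker ζ ↔ S x = x := by
  have hd := hζ.dense_domain
  rw [hζ.mem_ker_iff_adjoint hq]
  constructor
  · intro h
    have := hP.eq_S hd h ζ.graph.zero_mem
    rwa [add_zero] at this
  · intro h
    have h1 := hP.S_mem x
    have h2 := hP.B'_mem x
    have h3 := inner_eq_of_mem_graph_adjoint hd h2 h1
    rw [h, sub_self, inner_zero_left] at h3
    rwa [inner_self_eq_zero.1 h3.symm, h] at h1

theorem mem_ker_of_B' (hP : IsGraphProjection ζ R S B B') (hq : q ≠ 0) (hζ : IsQNormal q ζ)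
    {x : H} (h : B' x = 0) : x ∈ ker ζ := by
  rw [hP.mem_ker_iff_S hq hζ]
  exact (sub_eq_zero.1 (ζ.graph_fst_eq_zero_snd (hP.B'_mem x) h)).symm

end IsGraphProjection

end Kernel

/-! ### Bounded operators and conjugation of the functional calculus. -/

section Operators

variable {H : Type*} [NormedAddCommGroup H] [InnerProductSpace ℂ H]

theorem re_inner_nonneg {T : H →L[ℂ] H} (hT : 0 ≤ T) (x : H) : 0 ≤ RCLike.re ⟪T x, x⟫_ℂ :=
  ((ContinuousLinearMap.nonneg_iff_isPositive T).1 hT).re_inner_nonneg_left x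

theorem nonneg_of_symm {T : H →L[ℂ] H} (hs : ∀ x y, ⟪T x, y⟫_ℂ = ⟪x, T y⟫_ℂ)
    (h : ∀ x, 0 ≤ RCLike.re ⟪T x, x⟫_ℂ) : 0 ≤ T := by
  rw [ContinuousLinearMap.nonneg_iff_isPositive, ContinuousLinearMap.isPositive_def]
  exact ⟨hs, h⟩

theorem re_inner_real_smul (c : ℝ) (x y : H) :
    RCLike.re ⟪c • x, y⟫_ℂ = c * RCLike.re ⟪x, y⟫_ℂ := by
  rw [RCLike.real_smul_eq_coe_smul (K := ℂ), inner_smul_left, RCLike.conj_ofReal,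
    RCLike.re_ofReal_mul]

variable [CompleteSpace H]

/-- Two operators with dense ranges and equal norms pointwise differ by a unitary. -/
theorem exists_linearIsometryEquiv_comp_eq {V V' : H →L[ℂ] H} (hn : ∀ x, ‖V x‖ = ‖V' x‖)
    (hV : DenseRange V) (hV' : DenseRange V') : ∃ W : H ≃ₗᵢ[ℂ] H, ∀ x, W (V x) = V' x := by
  let L : H →L[ℂ] H := (V' : H →ₗ[ℂ] H).extendOfNorm (V : H →ₗ[ℂ] H)
  have hL : ∀ x, L (V x) = V' x :=
    LinearMap.extendOfNorm_eq (f := (V' : H →ₗ[ℂ] H)) (e := (V : H →ₗ[ℂ] H)) hV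
      ⟨1, fun x => by simp [hn x]⟩
  have hiso : ∀ x, ‖L x‖ = ‖x‖ := fun x =>
    hV.induction_on (p := fun x => ‖L x‖ = ‖x‖) x
      (isClosed_eq (by fun_prop) (by fun_prop)) fun y => by rw [hL, hn]
  let L' : H →ₗᵢ[ℂ] H := ⟨L, hiso⟩
  have hsurj : Function.Surjective L' := by
    have h1 : IsClosed (Set.range L') := L'.isometry.isClosedEmbedding.isClosed_range
    have h2 : Dense (Set.range L') := hV'.mono (by
      rintro _ ⟨x, rfl⟩
      exact ⟨V x, hL x⟩)
    rw [← Set.range_eq_univ, ← h1.closure_eq, h2.closure_eq]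
  exact ⟨LinearIsometryEquiv.ofSurjective L' hsurj, hL⟩

theorem denseRange_of_adjoint_injective {V V' : H →L[ℂ] H} (h : ∀ x y, ⟪V x, y⟫_ℂ = ⟪x, V' y⟫_ℂ)
    (hV' : ∀ y, V' y = 0 → y = 0) : DenseRange V := by
  have h1 : (LinearMap.range (V : H →ₗ[ℂ] H))ᗮ = ⊥ := by
    rw [Submodule.eq_bot_iff]
    intro y hy
    rw [Submodule.mem_orthogonal] at hy
    apply hV'
    rw [← inner_self_eq_zero (𝕜 := ℂ), ← h]
    exact hy _ ⟨_, rfl⟩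
  have := (Submodule.dense_iff_topologicalClosure_eq_top).2
    ((Submodule.topologicalClosure_eq_top_iff).2 h1)
  exact this.mono (by rintro _ ⟨x, rfl⟩; exact ⟨x, rfl⟩)

theorem cfc_symm (f : ℝ → ℝ) (T : H →L[ℂ] H) (x y : H) :
    ⟪cfc f T x, y⟫_ℂ = ⟪x, cfc f T y⟫_ℂ := by
  have h : IsSelfAdjoint (cfc f T) := cfc_predicate f T
  exact h.isSymmetric x y

theorem cfc_apply_mul {f g : ℝ → ℝ} {T : H →L[ℂ] H} (hf : ContinuousOn f (spectrum ℝ T))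
    (hg : ContinuousOn g (spectrum ℝ T)) (x : H) :
    cfc (fun r => f r * g r) T x = cfc f T (cfc g T x) := by
  rw [cfc_mul f g T hf hg, mul_apply_eq_comp]

theorem cfc_apply_comm (f g : ℝ → ℝ) (T : H →L[ℂ] H) (x : H) :
    cfc f T (cfc g T x) = cfc g T (cfc f T x) := by
  have := cfc_commute_cfc f g T
  rw [← mul_apply_eq_comp, this.eq, mul_apply_eq_comp]

theorem conj_cfc (W : H ≃ₗᵢ[ℂ] H) {R S : H →L[ℂ] H} (hR : IsSelfAdjoint R)
    (hW : ∀ x, W (R x) = S (W x)) {f : ℝ → ℝ} (hf : ContinuousOn f (spectrum ℝ R)) (x : H) :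
    W (cfc f R x) = cfc f S (W x) := by
  have h1 : W.conjStarAlgEquiv R = S := by
    ext y
    rw [LinearIsometryEquiv.conjStarAlgEquiv_apply_apply, hW, W.apply_symm_apply]
  have hc : Continuous W.conjStarAlgEquiv :=
    W.toContinuousLinearEquiv.conjContinuousAlgEquiv.continuous
  have h2 : W.conjStarAlgEquiv (cfc f R) = cfc f (W.conjStarAlgEquiv R) :=
    StarAlgHomClass.map_cfc (S := ℂ) W.conjStarAlgEquiv f R hf hc hR (hR.map _)
  rw [h1] at h2
  rw [← h2, LinearIsometryEquiv.conjStarAlgEquiv_apply_apply, W.symm_apply_apply]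

theorem spectrum_subset_Icc {T : H →L[ℂ] H} (h0 : 0 ≤ T) (h1 : T ≤ 1) :
    spectrum ℝ T ⊆ Set.Icc 0 1 := fun r hr =>
  ⟨spectrum_nonneg_of_nonneg h0 hr,
    (CFC.le_one_iff (R := ℝ) T (IsSelfAdjoint.of_nonneg h0)).1 h1 r hr⟩

end Operators

/-! ### The Möbius maps that rescale `t` in `1 / (1 + t)`. -/

section Moebius

/-- The map `1 / (1 + t) ↦ 1 / (1 + a t)` of the unit interval. -/
noncomputable def moebius (a r : ℝ) : ℝ := r / (a + (1 - a) * r)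

theorem moebius_den_pos {a r : ℝ} (ha : 0 < a) (hr : r ∈ Set.Icc (0 : ℝ) 1) :
    0 < a + (1 - a) * r := by
  obtain ⟨h0, h1⟩ := hr
  rcases h0.eq_or_lt with rfl | h0
  · simpa
  · nlinarith [mul_nonneg ha.le (sub_nonneg.2 h1)]

theorem continuousOn_moebius {a : ℝ} (ha : 0 < a) :
    ContinuousOn (moebius a) (Set.Icc (0 : ℝ) 1) :=
  ContinuousOn.div (by fun_prop) (by fun_prop) fun _ hr => (moebius_den_pos ha hr).ne'

theorem moebius_mem {a r : ℝ} (ha : 0 < a) (hr : r ∈ Set.Icc (0 : ℝ) 1) :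
    moebius a r ∈ Set.Icc (0 : ℝ) 1 := by
  have h := moebius_den_pos ha hr
  refine ⟨div_nonneg hr.1 h.le, (div_le_one h).2 ?_⟩
  nlinarith [mul_nonneg ha.le (sub_nonneg.2 hr.2)]

theorem moebius_moebius {a b r : ℝ} (ha : 0 < a) (hb : 0 < b) (hr : r ∈ Set.Icc (0 : ℝ) 1) :
    moebius a (moebius b r) = moebius (a * b) r := by
  have h1 := moebius_den_pos hb hr
  have h2 := moebius_den_pos (mul_pos ha hb) hr
  have h3 := moebius_den_pos ha (moebius_mem hb hr)
  have e : (a + (1 - a) * moebius b r) * (b + (1 - b) * r) = a * b + (1 - a * b) * r := by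
    rw [add_mul, mul_assoc, moebius, div_mul_cancel₀ _ h1.ne']
    ring
  rw [moebius.eq_1 a, moebius.eq_1 (a * b), div_eq_div_iff h3.ne' h2.ne', ← e]
  have e2 : moebius b r * (b + (1 - b) * r) = r := div_mul_cancel₀ _ h1.ne'
  linear_combination (a + (1 - a) * moebius b r) * e2

end Moebius

/-! ### The unitary polar factor of `ζ`. -/

section Polar

variable {H : Type*} [NormedAddCommGroup H] [InnerProductSpace ℂ H] [CompleteSpace H]

/-- A positive contraction `R`, injective, together with a unitary `W` that conjugates it to
`moebius (q ^ 2)` of `R`. -/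
structure IsMoebiusPair (q : ℝ) (R : H →L[ℂ] H) (W : H ≃ₗᵢ[ℂ] H) : Prop where
  nonneg : 0 ≤ R
  le_one : R ≤ 1
  injective : ∀ x, R x = 0 → x = 0
  intertwine : ∀ x, W (R x) = cfc (moebius (q ^ 2)) R (W x)

/-- The operator `√(R (1 - R))`. -/
noncomputable def sqrtMul (R : H →L[ℂ] H) : H →L[ℂ] H := cfc (fun r : ℝ => √(r * (1 - r))) R

variable {q : ℝ} {ζ : H →ₗ.[ℂ] H} {R S B B' : H →L[ℂ] H}

theorem cfc_affine (hR : IsSelfAdjoint R) (a b : ℝ) (x : H) :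
    cfc (fun r : ℝ => a + b * r) R x = (a : ℂ) • x + (b : ℂ) • R x := by
  rw [cfc_const_add a (fun r => b * r) R, cfc_const_mul_id b R]
  simp [Algebra.algebraMap_eq_smul_one]

theorem sqrtMul_sqrtMul (h0 : 0 ≤ R) (h1 : R ≤ 1) (x : H) :
    sqrtMul R (sqrtMul R x) = R x - R (R x) := by
  have hR := IsSelfAdjoint.of_nonneg h0
  rw [sqrtMul, ← cfc_apply_mul (by fun_prop) (by fun_prop)]
  have : cfc (fun r : ℝ => √(r * (1 - r)) * √(r * (1 - r))) R = cfc (fun r : ℝ => r - r * r) R := by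
    refine cfc_congr fun r hr => ?_
    obtain ⟨ha, hb⟩ := spectrum_subset_Icc h0 h1 hr
    rw [Real.mul_self_sqrt (mul_nonneg ha (sub_nonneg.2 hb))]
    ring
  rw [this, cfc_sub (fun r : ℝ => r) (fun r => r * r) R, cfc_mul (fun r : ℝ => r) (fun r => r) R,
    cfc_id' ℝ R]
  rfl

theorem sqrtMul_nonneg (R : H →L[ℂ] H) : 0 ≤ sqrtMul R :=
  cfc_nonneg fun _ _ => Real.sqrt_nonneg _

theorem sqrtMul_comm (hR : IsSelfAdjoint R) (x : H) : sqrtMul R (R x) = R (sqrtMul R x) := by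
  have := cfc_apply_comm (fun r : ℝ => √(r * (1 - r))) (fun r => r) R x
  rwa [cfc_id' ℝ R] at this

theorem cfc_comm_self (hR : IsSelfAdjoint R) (f : ℝ → ℝ) (x : H) :
    cfc f R (R x) = R (cfc f R x) := by
  have := cfc_apply_comm f (fun r => r) R x
  rwa [cfc_id' ℝ R] at this

namespace IsGraphProjection

theorem S_eq_cfc (hP : IsGraphProjection ζ R S B B') (hζ : IsQNormal q ζ) (hq : 0 < q) :
    S = cfc (moebius (q ^ 2)) R := by
  have h0 := hP.R_nonneg hζ.dense_domain
  have hsp := spectrum_subset_Icc h0 (hP.R_le_one hζ.dense_domain)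
  have hR := IsSelfAdjoint.of_nonneg h0
  have hq2 : 0 < q ^ 2 := by positivity
  have hden : ContinuousOn (fun r : ℝ => (q ^ 2 + (1 - q ^ 2) * r)⁻¹) (spectrum ℝ R) :=
    ContinuousOn.inv₀ (by fun_prop) fun r hr => (moebius_den_pos hq2 (hsp hr)).ne'
  ext x
  have h1 : ∀ y, S (cfc (fun r : ℝ => q ^ 2 + (1 - q ^ 2) * r) R y) = R y := fun y => by
    rw [cfc_affine hR]
    have := congrArg (fun T : H →L[ℂ] H => T y) (hP.S_mul hζ)
    simpa using this
  have h2 : ∀ y, cfc (fun r : ℝ => q ^ 2 + (1 - q ^ 2) * r) R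
      (cfc (fun r : ℝ => (q ^ 2 + (1 - q ^ 2) * r)⁻¹) R y) = y := fun y => by
    rw [← cfc_apply_mul (by fun_prop) hden]
    have : cfc (fun r : ℝ => (q ^ 2 + (1 - q ^ 2) * r) * (q ^ 2 + (1 - q ^ 2) * r)⁻¹) R = 1 := by
      rw [← cfc_const_one ℝ R]
      exact cfc_congr fun r hr => mul_inv_cancel₀ (moebius_den_pos hq2 (hsp hr)).ne'
    rw [this]
    rfl
  rw [← h2 x, h1, h2]
  have := cfc_apply_mul (T := R) (f := fun r => r) (by fun_prop) hden x
  rw [cfc_id' ℝ R] at this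
  rw [← this]
  rfl

/-- `sqrtMul R` and `B` have equal norms pointwise because `B* B = R (1 - R)`. Both vanish on `ker
ζ` and have range orthogonal to it, so adding the projection `P` onto the kernel keeps the norms
equal and makes both ranges dense. The intertwining relation comes from `B R = S B` on the range of
`sqrtMul R` and from `R = S = 1` on the kernel. -/
theorem exists_polar (hP : IsGraphProjection ζ R S B B') (hζ : IsQNormal q ζ) (hq : 0 < q) :
    ∃ W : H ≃ₗᵢ[ℂ] H, IsMoebiusPair q R W ∧ (∀ x, W (sqrtMul R x) = B x) ∧
      ∀ x ∈ ker ζ, W x = x := by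
  have hd := hζ.dense_domain
  have h0 := hP.R_nonneg hd
  have h1 := hP.R_le_one hd
  have hR := IsSelfAdjoint.of_nonneg h0
  have hcl : IsClosed (ker ζ : Set H) := by
    have : (ker ζ : Set H) = {x | B x = 0} := Set.ext fun x => hP.mem_ker_iff_B hd
    rw [this]
    exact isClosed_eq B.continuous continuous_const
  have : CompleteSpace (ker ζ) := hcl.completeSpace_coe
  let P : H →L[ℂ] H := (ker ζ).starProjection
  have hPs : ∀ x y, ⟪P x, y⟫_ℂ = ⟪x, P y⟫_ℂ := (ker ζ).inner_starProjection_left_eq_right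
  have hPm : ∀ x, P x ∈ ker ζ := (ker ζ).starProjection_apply_mem
  have hPk : ∀ x ∈ ker ζ, P x = x := fun x hx => Submodule.starProjection_eq_self_iff.2 hx
  have hCs : ∀ x y, ⟪sqrtMul R x, y⟫_ℂ = ⟪x, sqrtMul R y⟫_ℂ := cfc_symm _ _
  have hCn : ∀ x, ‖sqrtMul R x‖ = ‖B x‖ := fun x => by
    have e : ⟪sqrtMul R x, sqrtMul R x⟫_ℂ = ⟪B x, B x⟫_ℂ := by
      rw [hP.norm_B_sq hd, hCs, sqrtMul_sqrtMul h0 h1, ← map_sub, hP.R_symm]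
    rw [inner_self_eq_norm_sq_to_K, inner_self_eq_norm_sq_to_K] at e
    have e' : ‖sqrtMul R x‖ ^ 2 = ‖B x‖ ^ 2 := by exact_mod_cast e
    exact (sq_eq_sq₀ (norm_nonneg _) (norm_nonneg _)).1 e'
  have hBk : ∀ x ∈ ker ζ, B x = 0 := fun x hx => (hP.mem_ker_iff_B hd).1 hx
  have hCk : ∀ x ∈ ker ζ, sqrtMul R x = 0 := fun x hx => by
    rw [← norm_eq_zero, hCn, hBk x hx, norm_zero]
  have hCo : ∀ x, ∀ y ∈ ker ζ, ⟪sqrtMul R x, y⟫_ℂ = 0 := fun x y hy => by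
    rw [hCs, hCk y hy, inner_zero_right]
  have hBo : ∀ x, ∀ y ∈ ker ζ, ⟪B x, y⟫_ℂ = 0 := fun x y hy => by
    have := inner_eq_of_mem_graph_adjoint hd (hP.R_mem x) ((hζ.mem_ker_iff_adjoint hq.ne').1 hy)
    rwa [inner_zero_right] at this
  have hB'o : ∀ x, ∀ y ∈ ker ζ, ⟪y, B' x⟫_ℂ = 0 := fun x y hy => by
    rw [← hP.B_adj, hBk y hy, inner_zero_left]
  have hnorm : ∀ x, ‖(sqrtMul R + P) x‖ = ‖(B + P) x‖ := fun x => by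
    have a1 := norm_add_sq_eq_norm_sq_add_norm_sq_of_inner_eq_zero _ _ (hCo x (P x) (hPm x))
    have a2 := norm_add_sq_eq_norm_sq_add_norm_sq_of_inner_eq_zero _ _ (hBo x (P x) (hPm x))
    rw [hCn, ← a2] at a1
    exact (mul_self_inj (norm_nonneg _) (norm_nonneg _)).1 a1
  have hdV : DenseRange (sqrtMul R + P) := by
    refine denseRange_of_adjoint_injective (V' := sqrtMul R + P) (fun x y => ?_) fun y hy => ?_
    · simp [hCs, hPs]
    · have a1 := norm_add_sq_eq_norm_sq_add_norm_sq_of_inner_eq_zero _ _ (hCo y (P y) (hPm y))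
      have hy' : sqrtMul R y + P y = 0 := hy
      rw [hy', norm_zero] at a1
      have b1 : sqrtMul R y = 0 := by
        rw [← norm_eq_zero]
        nlinarith [mul_self_nonneg ‖sqrtMul R y‖, mul_self_nonneg ‖P y‖]
      have b2 : y ∈ ker ζ := by
        rw [hP.mem_ker_iff_B hd, ← norm_eq_zero, ← hCn, b1, norm_zero]
      rwa [b1, zero_add, hPk y b2] at hy'
  have hdV' : DenseRange (B + P) := by
    refine denseRange_of_adjoint_injective (V' := B' + P) (fun x y => ?_) fun y hy => ?_
    · simp [hP.B_adj, hPs]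
    · have a1 := norm_add_sq_eq_norm_sq_add_norm_sq_of_inner_eq_zero _ _ (hB'o y (P y) (hPm y))
      have hy' : B' y + P y = 0 := hy
      rw [add_comm (P y), hy', norm_zero] at a1
      have b1 : B' y = 0 := by
        rw [← norm_eq_zero]
        nlinarith [mul_self_nonneg ‖B' y‖, mul_self_nonneg ‖P y‖]
      rwa [b1, zero_add, hPk y (hP.mem_ker_of_B' hq.ne' hζ b1)] at hy'
  obtain ⟨W, hW⟩ := exists_linearIsometryEquiv_comp_eq hnorm hdV hdV'
  have hWk : ∀ x ∈ ker ζ, W x = x := fun x hx => by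
    have := hW x
    simpa [hCk x hx, hBk x hx, hPk x hx] using this
  have hWC : ∀ x, W (sqrtMul R x) = B x := fun x => by
    have := hW x
    simpa [hWk (P x) (hPm x)] using this
  refine ⟨W, ⟨h0, h1, fun x => hP.R_injective, ?_⟩, hWC, hWk⟩
  rw [← hP.S_eq_cfc hζ hq]
  intro x
  refine hdV.induction_on (p := fun x => W (R x) = S (W x)) x
    (isClosed_eq (by fun_prop) (by fun_prop)) fun y => ?_
  have hBR : B (R y) = S (B y) :=
    congrArg (fun T : H →L[ℂ] H => T y) (hP.B_mul_R hd)
  change W (R (sqrtMul R y + P y)) = S (W (sqrtMul R y + P y))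
  rw [map_add, map_add, ← sqrtMul_comm hR, hWC, map_add, map_add, hWC, hBR,
    (hP.mem_ker_iff_R hd).1 (hPm y), hWk _ (hPm y), (hP.mem_ker_iff_S hq.ne' hζ).1 (hPm y)]

end IsGraphProjection

end Polar

/-! ### The spectral subspace `T ≥ 1/2` by continuous functional calculus. -/

section SpectralCut

variable {H : Type*} [NormedAddCommGroup H] [InnerProductSpace ℂ H] [CompleteSpace H]
  {T : H →L[ℂ] H} {f g k : ℝ → ℝ}

theorem re_inner_cfc_mono (hf : ContinuousOn f (spectrum ℝ T)) (hg : ContinuousOn g (spectrum ℝ T))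
    (h : ∀ r ∈ spectrum ℝ T, f r ≤ g r) (x : H) :
    RCLike.re ⟪cfc f T x, x⟫_ℂ ≤ RCLike.re ⟪cfc g T x, x⟫_ℂ := by
  have h1 := re_inner_nonneg (sub_nonneg.2 (cfc_mono h hf hg)) x
  rwa [sub_apply, inner_sub_left, map_sub, sub_nonneg] at h1

theorem norm_cfc_apply_sq (hf : ContinuousOn f (spectrum ℝ T)) (x : H) :
    ‖cfc f T x‖ ^ 2 = RCLike.re ⟪cfc (fun r => f r * f r) T x, x⟫_ℂ := by
  rw [cfc_apply_mul hf hf, cfc_symm, inner_self_eq_norm_sq]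

theorem norm_cfc_apply_mono (hf : ContinuousOn f (spectrum ℝ T))
    (hg : ContinuousOn g (spectrum ℝ T)) (h : ∀ r ∈ spectrum ℝ T, |f r| ≤ |g r|) (x : H) :
    ‖cfc f T x‖ ≤ ‖cfc g T x‖ := by
  rw [← sq_le_sq₀ (norm_nonneg _) (norm_nonneg _), norm_cfc_apply_sq hf, norm_cfc_apply_sq hg]
  exact re_inner_cfc_mono (hf.mul hf) (hg.mul hg)
    (fun r hr => abs_le_iff_mul_self_le.1 (h r hr)) x

/-- The spectral subspace of `T` for the half-line `[1/2, ∞)`. -/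
noncomputable def cut (T : H →L[ℂ] H) : Submodule ℂ H :=
  LinearMap.ker ((cfc (fun r : ℝ => max (1 / 2 - r) 0) T : H →L[ℂ] H) : H →ₗ[ℂ] H)

theorem mem_cut {x : H} : x ∈ cut T ↔ cfc (fun r : ℝ => max (1 / 2 - r) 0) T x = 0 := Iff.rfl

theorem isClosed_cut (T : H →L[ℂ] H) : IsClosed (cut T : Set H) :=
  isClosed_eq (cfc (fun r : ℝ => max (1 / 2 - r) 0) T).continuous continuous_const

instance (T : H →L[ℂ] H) : CompleteSpace (cut T) := (isClosed_cut T).completeSpace_coe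

theorem cfc_mem_cut (f : ℝ → ℝ) {x : H} (hx : x ∈ cut T) : cfc f T x ∈ cut T := by
  rw [mem_cut, cfc_apply_comm, mem_cut.1 hx, map_zero]

theorem cfc_mem_cut_orthogonal (f : ℝ → ℝ) {x : H} (hx : x ∈ (cut T)ᗮ) :
    cfc f T x ∈ (cut T)ᗮ := by
  rw [Submodule.mem_orthogonal] at hx ⊢
  intro u hu
  rw [← cfc_symm]
  exact hx _ (cfc_mem_cut f hu)

theorem cfc_posPart_eq_zero {x : H} (hx : x ∈ (cut T)ᗮ) :
    cfc (fun r : ℝ => max (r - 1 / 2) 0) T x = 0 := by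
  have h : ∀ y, cfc (fun r : ℝ => max (r - 1 / 2) 0) T y ∈ cut T := fun y => by
    rw [mem_cut, ← cfc_apply_mul (by fun_prop) (by fun_prop)]
    have : cfc (fun r : ℝ => max (1 / 2 - r) 0 * max (r - 1 / 2) 0) T = 0 := by
      rw [← cfc_const_zero ℝ T]
      refine cfc_congr fun r _ => ?_
      rcases le_total r (1 / 2) with h | h
      · rw [max_eq_right (sub_nonpos.2 h), mul_zero]
      · rw [max_eq_right (sub_nonpos.2 h), zero_mul]
    rw [this]
    rfl
  rw [← inner_self_eq_zero (𝕜 := ℂ), ← cfc_symm]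
  exact (Submodule.mem_orthogonal _ _).1 hx _ (h _)

/-- Splits `r - 1/2` into positive and negative parts. The negative part annihilates `cut T` and the
positive part annihilates its complement, which fixes the sign of the quadratic form on each. -/
theorem cfc_mul_sub_half (hk : ContinuousOn k (spectrum ℝ T)) (x : H) :
    cfc (fun r => k r * (r - 1 / 2)) T x =
      cfc (fun r => k r * max (r - 1 / 2) 0) T x -
        cfc k T (cfc (fun r : ℝ => max (1 / 2 - r) 0) T x) := by
  rw [← cfc_apply_mul hk (by fun_prop), ← sub_apply,
    ← cfc_sub (fun r => k r * max (r - 1 / 2) 0) (fun r => k r * max (1 / 2 - r) 0) T]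
  congr 2
  ext r
  rw [← mul_sub]
  rcases le_total r (1 / 2) with h | h
  · rw [max_eq_right (sub_nonpos.2 h), max_eq_left (sub_nonneg.2 h)]
    ring
  · rw [max_eq_right (sub_nonpos.2 h), max_eq_left (sub_nonneg.2 h)]
    ring

theorem re_inner_nonneg_of_mem_cut (hk : ContinuousOn k (spectrum ℝ T))
    (hk0 : ∀ r ∈ spectrum ℝ T, 0 ≤ k r) {x : H} (hx : x ∈ cut T) :
    0 ≤ RCLike.re ⟪cfc (fun r => k r * (r - 1 / 2)) T x, x⟫_ℂ := by
  rw [cfc_mul_sub_half hk, mem_cut.1 hx, map_zero, sub_zero]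
  exact re_inner_nonneg (cfc_nonneg fun r hr => mul_nonneg (hk0 r hr) (le_max_right _ _)) x

theorem re_inner_nonpos_of_mem_cut_orthogonal (hk : ContinuousOn k (spectrum ℝ T))
    (hk0 : ∀ r ∈ spectrum ℝ T, 0 ≤ k r) {x : H} (hx : x ∈ (cut T)ᗮ) :
    RCLike.re ⟪cfc (fun r => k r * (r - 1 / 2)) T x, x⟫_ℂ ≤ 0 := by
  rw [cfc_mul_sub_half hk, cfc_apply_mul hk (by fun_prop), cfc_posPart_eq_zero hx, map_zero,
    zero_sub, inner_neg_left, map_neg, neg_nonpos, ← cfc_apply_mul hk (by fun_prop)]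
  exact re_inner_nonneg (cfc_nonneg fun r hr => mul_nonneg (hk0 r hr) (le_max_right _ _)) x

end SpectralCut

/-! ### How powers of `W` move the cut. -/

section MoebiusPair

variable {H : Type*} [NormedAddCommGroup H] [InnerProductSpace ℂ H] [CompleteSpace H]
  {q : ℝ} {R : H →L[ℂ] H} {W : H ≃ₗᵢ[ℂ] H}

/-- On the cut `|ζ|` is everywhere defined and bounded by 1: `z` plays the role of `R⁻¹ y`, and
`sqrtMul R z` that of `|ζ| y`. -/
theorem exists_of_mem_cut (h0 : 0 ≤ R) (h1 : R ≤ 1) {y : H} (hy : y ∈ cut R) :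
    ∃ z, R z = y ∧ ‖sqrtMul R z‖ ≤ ‖y‖ := by
  have hR := IsSelfAdjoint.of_nonneg h0
  have hsp := spectrum_subset_Icc h0 h1
  have hpos : ∀ r : ℝ, 0 < max r (1 / 2) := fun r => lt_max_of_lt_right (by norm_num)
  have hc : Continuous fun r : ℝ => (max r (1 / 2))⁻¹ :=
    Continuous.inv₀ (by fun_prop) fun r => (hpos r).ne'
  -- Truncating at `1/2` makes the inverse continuous; on the cut it still inverts `R`.
  set z := cfc (fun r : ℝ => (max r (1 / 2))⁻¹) R y with hz
  have hRz : R z = y := by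
    have e1 : R z = cfc (fun r : ℝ => r * (max r (1 / 2))⁻¹) R y := by
      rw [cfc_apply_mul (by fun_prop) hc.continuousOn, cfc_id' ℝ R]
    have e2 : (fun r : ℝ => r * (max r (1 / 2))⁻¹) =
        fun r => 1 - (max r (1 / 2))⁻¹ * max (1 / 2 - r) 0 := by
      ext r
      have := (hpos r).ne'
      field_simp
      rcases le_total r (1 / 2) with h | h
      · rw [max_eq_right h, max_eq_left (by linarith)]; ring
      · rw [max_eq_left h, max_eq_right (by linarith)]; ring
    rw [e1, e2, cfc_sub (fun _ => 1) (fun r => (max r (1 / 2))⁻¹ * max (1 / 2 - r) 0) R (by fun_prop)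
        (by fun_prop),
      cfc_const_one ℝ R, sub_apply, cfc_apply_mul hc.continuousOn (by fun_prop),
      mem_cut.1 hy, map_zero, sub_zero]
    rfl
  refine ⟨z, hRz, ?_⟩
  have hzc : z ∈ cut R := cfc_mem_cut _ hy
  rw [← hRz, ← sq_le_sq₀ (norm_nonneg _) (norm_nonneg _), sqrtMul, norm_cfc_apply_sq (by fun_prop)]
  have e3 : ‖R z‖ ^ 2 = RCLike.re ⟪cfc (fun r : ℝ => r * r) R z, z⟫_ℂ := by
    rw [← norm_cfc_apply_sq (by fun_prop), cfc_id' ℝ R]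
  have e4 : cfc (fun r : ℝ => √(r * (1 - r)) * √(r * (1 - r))) R =
      cfc (fun r : ℝ => r * r - (2 * r) * (r - 1 / 2)) R := by
    refine cfc_congr fun r hr => ?_
    obtain ⟨ha, hb⟩ := hsp hr
    rw [Real.mul_self_sqrt (mul_nonneg ha (sub_nonneg.2 hb))]
    ring
  have e5 := re_inner_nonneg_of_mem_cut (k := fun r => 2 * r) (T := R) (by fun_prop)
    (fun r hr => by have := (hsp hr).1; positivity) hzc
  rw [e3, e4, cfc_sub _ _ R, sub_apply, inner_sub_left, map_sub]
  linarith

theorem mem_cut_of_fixed (h0 : 0 ≤ R) (h1 : R ≤ 1) {x : H} (hx : R x = x) : x ∈ cut R := by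
  have hR := IsSelfAdjoint.of_nonneg h0
  rw [mem_cut, ← norm_le_zero_iff]
  have h := norm_cfc_apply_mono (T := R) (f := fun r => max (1 / 2 - r) 0)
    (g := fun r => 1 + (-1) * r) (by fun_prop) (by fun_prop) (fun r hr => ?_) x
  · rw [cfc_affine hR, hx] at h
    simpa using h
  · obtain ⟨ha, hb⟩ := spectrum_subset_Icc h0 h1 hr
    rw [abs_of_nonneg (le_max_right _ _), abs_of_nonneg (by linarith)]
    exact max_le (by linarith) (by linarith)

namespace IsMoebiusPair

theorem isSelfAdjoint (h : IsMoebiusPair q R W) : IsSelfAdjoint R := IsSelfAdjoint.of_nonneg h.nonneg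

theorem spectrum_subset (h : IsMoebiusPair q R W) : spectrum ℝ R ⊆ Set.Icc 0 1 :=
  spectrum_subset_Icc h.nonneg h.le_one

theorem continuousOn_moebius (h : IsMoebiusPair q R W) {a : ℝ} (ha : 0 < a) :
    ContinuousOn (moebius a) (spectrum ℝ R) :=
  (QNormal.continuousOn_moebius ha).mono h.spectrum_subset

theorem cfc_conj (h : IsMoebiusPair q R W) (hq : 0 < q) {f : ℝ → ℝ}
    (hf : ContinuousOn f (Set.Icc 0 1)) (x : H) :
    W (cfc f R x) = cfc (fun r => f (moebius (q ^ 2) r)) R (W x) := by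
  have hq2 : 0 < q ^ 2 := by positivity
  rw [conj_cfc W h.isSelfAdjoint h.intertwine (hf.mono h.spectrum_subset)]
  rw [cfc_comp' f (moebius (q ^ 2)) R _ (h.continuousOn_moebius hq2) h.isSelfAdjoint]
  refine hf.mono ?_
  rintro _ ⟨r, hr, rfl⟩
  exact moebius_mem hq2 (h.spectrum_subset hr)

theorem cfc_conj_pow (h : IsMoebiusPair q R W) (hq : 0 < q) (n : ℕ) {f : ℝ → ℝ}
    (hf : ContinuousOn f (Set.Icc 0 1)) (x : H) :
    (W ^ n) (cfc f R x) = cfc (fun r => f (moebius ((q ^ 2) ^ n) r)) R ((W ^ n) x) := by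
  have hq2 : 0 < q ^ 2 := by positivity
  induction n generalizing f with
  | zero =>
    have : (fun r => f (moebius ((q ^ 2) ^ 0) r)) = f := by
      ext r
      simp [moebius]
    rw [this]
    rfl
  | succ n ih =>
    have hpn : 0 < (q ^ 2) ^ n := by positivity
    rw [pow_succ' W]
    change W ((W ^ n) (cfc f R x)) = cfc _ R (W ((W ^ n) x))
    rw [ih hf, h.cfc_conj (f := fun r => f (moebius ((q ^ 2) ^ n) r)) hq
      (hf.comp (QNormal.continuousOn_moebius hpn) fun r hr => moebius_mem hpn hr)]
    refine congrArg (fun T : H →L[ℂ] H => T _) (cfc_congr fun r hr => ?_)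
    rw [moebius_moebius hpn hq2 (h.spectrum_subset hr), ← pow_succ]

/-- Passing from `W x` to `x` replaces `r` by `moebius (q ^ 2) r ≥ r`, which can only shrink the
negative part of `r - 1/2`. -/
theorem mem_cut_of_apply (h : IsMoebiusPair q R W) (hq : 0 < q) (hq1 : q < 1) {x : H}
    (hx : W x ∈ cut R) : x ∈ cut R := by
  have hq2 : 0 < q ^ 2 := by positivity
  have hq3 : q ^ 2 < 1 := by nlinarith
  rw [mem_cut, ← norm_le_zero_iff, ← W.norm_map, h.cfc_conj hq (by fun_prop)]
  rw [mem_cut, ← norm_le_zero_iff] at hx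
  refine le_trans (norm_cfc_apply_mono ?_ (by fun_prop) (fun r hr => ?_) _) hx
  · have := h.continuousOn_moebius hq2
    fun_prop
  · rw [abs_of_nonneg (le_max_right _ _), abs_of_nonneg (le_max_right _ _)]
    refine max_le_max ?_ le_rfl
    have hr' := h.spectrum_subset hr
    have hd := moebius_den_pos hq2 hr'
    have : r ≤ moebius (q ^ 2) r := by
      rw [moebius, le_div_iff₀ hd]
      have h3 : 0 ≤ (1 - q ^ 2) * (1 - r) := mul_nonneg (by linarith) (by linarith [hr'.2])
      nlinarith [mul_nonneg hr'.1 h3]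
    linarith

/-- Heuristically `|ζ| > 1` at `y n` means `|ζ| > q^(-n)` at `x`, so `R x` is smaller than any
bound. Quantitatively, `‖R x‖² ≤ 2 q^(2n) ‖x‖²`. -/
theorem eq_zero_of_forall_mem_orthogonal (h : IsMoebiusPair q R W) (hq : 0 < q) (hq1 : q < 1)
    {x : H} {y : ℕ → H} (hy : ∀ n, (W ^ n) (y n) = x) (hyc : ∀ n, y n ∈ (cut R)ᗮ) : x = 0 := by
  have hsp := h.spectrum_subset
  have hR := h.isSelfAdjoint
  have hq2 : 0 < q ^ 2 := by positivity
  have hq3 : q ^ 2 < 1 := by nlinarith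
  have key : ∀ n : ℕ, ‖R x‖ ^ 2 ≤ (q ^ 2) ^ n * (2 * ‖x‖ ^ 2) := by
    intro n
    have hpn : 0 < (q ^ 2) ^ n := by positivity
    have hpi : 0 < ((q ^ 2) ^ n)⁻¹ := by positivity
    have hm := QNormal.continuousOn_moebius hpi
    -- The weight is chosen so that conjugation by `W ^ n` turns it into `r²`, as the two Möbius
    -- maps cancel.
    have h1 := re_inner_nonpos_of_mem_cut_orthogonal (T := R)
      (k := fun r => moebius ((q ^ 2) ^ n)⁻¹ r * moebius ((q ^ 2) ^ n)⁻¹ r)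
      ((hm.mul hm).mono hsp) (fun r _ => mul_self_nonneg _) (hyc n)
    rw [← (W ^ n).inner_map_map, h.cfc_conj_pow
      (f := fun r => moebius ((q ^ 2) ^ n)⁻¹ r * moebius ((q ^ 2) ^ n)⁻¹ r * (r - 1 / 2))
      hq n (by fun_prop), hy n] at h1
    have h2 : cfc (fun r => moebius ((q ^ 2) ^ n)⁻¹ (moebius ((q ^ 2) ^ n) r) *
        moebius ((q ^ 2) ^ n)⁻¹ (moebius ((q ^ 2) ^ n) r) *
        (moebius ((q ^ 2) ^ n) r - 1 / 2)) R =
        cfc (fun r => r * r * (moebius ((q ^ 2) ^ n) r - 1 / 2)) R := by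
      refine cfc_congr fun r hr => ?_
      have : moebius ((q ^ 2) ^ n)⁻¹ (moebius ((q ^ 2) ^ n) r) = r := by
        rw [moebius_moebius hpi hpn (hsp hr), inv_mul_cancel₀ hpn.ne']
        simp [moebius]
      simp only [this]
    have hmc := h.continuousOn_moebius hpn
    have h3 := re_inner_cfc_mono (T := R) (f := fun r => (1 / 2) * (r * r) - (q ^ 2) ^ n)
      (g := fun r => r * r * (moebius ((q ^ 2) ^ n) r - 1 / 2)) (by fun_prop) (by fun_prop)
      (fun r hr => ?_) x
    · rw [← h2] at h3
      have h4 := h3.trans h1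
      rw [cfc_sub _ _ R, cfc_const_mul _ _ R, cfc_const _ R, sub_apply,
        inner_sub_left, map_sub] at h4
      have h5 : RCLike.re ⟪cfc (fun r : ℝ => r * r) R x, x⟫_ℂ = ‖R x‖ ^ 2 := by
        rw [← norm_cfc_apply_sq (by fun_prop), cfc_id' ℝ R]
      have h6 : RCLike.re ⟪(algebraMap ℝ (H →L[ℂ] H) ((q ^ 2) ^ n)) x, x⟫_ℂ =
          (q ^ 2) ^ n * ‖x‖ ^ 2 := by
        rw [Algebra.algebraMap_eq_smul_one, smul_apply,
          re_inner_real_smul, one_apply_eq_self, inner_self_eq_norm_sq]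
      have h7 : RCLike.re ⟪((1 / 2 : ℝ) • cfc (fun r : ℝ => r * r) R) x, x⟫_ℂ =
          1 / 2 * ‖R x‖ ^ 2 := by
        rw [smul_apply, re_inner_real_smul, h5]
      rw [h6, h7] at h4
      linarith
    · have hr' := hsp hr
      have hd := moebius_den_pos hpn hr'
      have hmm := moebius_mem hpn hr'
      -- With `a = q^(2n)`, this identity gives `r² (1 - moebius a r) ≤ a`, hence the lower bound
      -- `r²/2 - a`.
      have e : r * (1 - moebius ((q ^ 2) ^ n) r) =
          (q ^ 2) ^ n * (moebius ((q ^ 2) ^ n) r * (1 - r)) := by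
        have e0 : moebius ((q ^ 2) ^ n) r * ((q ^ 2) ^ n + (1 - (q ^ 2) ^ n) * r) = r :=
          div_mul_cancel₀ _ hd.ne'
        linear_combination -e0
      have e1 : moebius ((q ^ 2) ^ n) r * (1 - r) ≤ 1 :=
        mul_le_one₀ hmm.2 (by linarith [hr'.2]) (by linarith [hr'.1])
      have e2 : r * (r * (1 - moebius ((q ^ 2) ^ n) r)) ≤ 1 * (q ^ 2) ^ n := by
        refine mul_le_mul hr'.2 ?_ (mul_nonneg hr'.1 (by linarith [hmm.2])) zero_le_one
        rw [e]
        exact mul_le_of_le_one_right hpn.le e1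
      nlinarith
  have hlim : Filter.Tendsto (fun n : ℕ => (q ^ 2) ^ n * (2 * ‖x‖ ^ 2)) Filter.atTop (nhds 0) := by
    simpa using (tendsto_pow_atTop_nhds_zero_of_lt_one hq2.le hq3).mul_const (2 * ‖x‖ ^ 2)
  have h8 : ‖R x‖ ^ 2 ≤ 0 := ge_of_tendsto' hlim key
  have h9 : ‖R x‖ = 0 := by nlinarith [norm_nonneg (R x)]
  exact h.injective x (norm_eq_zero.1 h9)

end IsMoebiusPair

end MoebiusPair

/-! ### The relation `|ζ| W⁻¹ = q W⁻¹ |ζ|`. -/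

section Scaling

variable {H : Type*} [NormedAddCommGroup H] [InnerProductSpace ℂ H] [CompleteSpace H]
  {q : ℝ} {R : H →L[ℂ] H} {W : H ≃ₗᵢ[ℂ] H}

namespace IsMoebiusPair

theorem cfc_moebius_den (h : IsMoebiusPair q R W) (hq : 0 < q) (x : H) :
    cfc (moebius (q ^ 2)) R (cfc (fun r : ℝ => q ^ 2 + (1 - q ^ 2) * r) R x) = R x := by
  have hq2 : 0 < q ^ 2 := by positivity
  rw [← cfc_apply_mul (h.continuousOn_moebius hq2) (by fun_prop)]
  have : cfc (fun r => moebius (q ^ 2) r * (q ^ 2 + (1 - q ^ 2) * r)) R = cfc (fun r => r) R :=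
    cfc_congr fun r hr => div_mul_cancel₀ _ (moebius_den_pos hq2 (h.spectrum_subset hr)).ne'
  rw [this, cfc_id' ℝ R h.isSelfAdjoint]

theorem apply_symm_den (h : IsMoebiusPair q R W) (hq : 0 < q) (x : H) :
    R (W.symm (cfc (fun r : ℝ => q ^ 2 + (1 - q ^ 2) * r) R x)) = W.symm (R x) := by
  apply W.injective
  rw [h.intertwine, W.apply_symm_apply, W.apply_symm_apply, h.cfc_moebius_den hq]

/-- With `apply_symm_den`, this says that `(u, v) ↦ (W⁻¹ u, q W⁻¹ v)` preserves the graph of `|ζ|`,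
described by the pairs `(R x, sqrtMul R x)`. -/
theorem sqrtMul_symm_den (h : IsMoebiusPair q R W) (hq : 0 < q) (x : H) :
    sqrtMul R (W.symm (cfc (fun r : ℝ => q ^ 2 + (1 - q ^ 2) * r) R x)) =
      (q : ℂ) • W.symm (sqrtMul R x) := by
  have hq2 : 0 < q ^ 2 := by positivity
  have hm := h.continuousOn_moebius hq2
  apply W.injective
  rw [map_smul, W.apply_symm_apply, sqrtMul, h.cfc_conj hq (by fun_prop), W.apply_symm_apply,
    ← cfc_apply_mul (by fun_prop) (by fun_prop)]
  have : cfc (fun r => √(moebius (q ^ 2) r * (1 - moebius (q ^ 2) r)) *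
      (q ^ 2 + (1 - q ^ 2) * r)) R = cfc (fun r : ℝ => q * √(r * (1 - r))) R := by
    refine cfc_congr fun r hr => ?_
    have hr' := h.spectrum_subset hr
    have hd := moebius_den_pos hq2 hr'
    have e0 : moebius (q ^ 2) r * (q ^ 2 + (1 - q ^ 2) * r) = r := div_mul_cancel₀ _ hd.ne'
    have e1 : √((q ^ 2 + (1 - q ^ 2) * r) ^ 2) = q ^ 2 + (1 - q ^ 2) * r := Real.sqrt_sq hd.le
    have e2 : √(q ^ 2) = q := Real.sqrt_sq hq.le
    have hmm := moebius_mem hq2 hr'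
    have e3 : (moebius (q ^ 2) r * (1 - moebius (q ^ 2) r)) * (q ^ 2 + (1 - q ^ 2) * r) ^ 2 =
        q ^ 2 * (r * (1 - r)) := by
      linear_combination (q ^ 2 + (1 - q ^ 2) * r - r - moebius (q ^ 2) r *
        (q ^ 2 + (1 - q ^ 2) * r)) * e0
    calc _ = √(moebius (q ^ 2) r * (1 - moebius (q ^ 2) r)) *
          √((q ^ 2 + (1 - q ^ 2) * r) ^ 2) := by rw [e1]
      _ = √(q ^ 2) * √(r * (1 - r)) := by
        rw [← Real.sqrt_mul (mul_nonneg hmm.1 (by linarith [hmm.2])), e3, Real.sqrt_mul hq2.le]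
      _ = _ := by rw [e2]
  rw [this, cfc_const_mul _ _ R]
  rfl

theorem exists_symm (h : IsMoebiusPair q R W) (hq : 0 < q) (x : H) :
    ∃ x', R x' = W.symm (R x) ∧ sqrtMul R x' = (q : ℂ) • W.symm (sqrtMul R x) :=
  ⟨_, h.apply_symm_den hq x, h.sqrtMul_symm_den hq x⟩

theorem exists_apply (h : IsMoebiusPair q R W) (hq : 0 < q) (x : H) :
    ∃ x', R x' = W (R x) ∧ sqrtMul R x' = (q : ℂ)⁻¹ • W (sqrtMul R x) := by
  have hq2 : 0 < q ^ 2 := by positivity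
  have hden : ContinuousOn (fun r : ℝ => (q ^ 2 + (1 - q ^ 2) * r)⁻¹) (spectrum ℝ R) :=
    ContinuousOn.inv₀ (by fun_prop) fun r hr => (moebius_den_pos hq2 (h.spectrum_subset hr)).ne'
  set x' := cfc (fun r : ℝ => (q ^ 2 + (1 - q ^ 2) * r)⁻¹) R (W x) with hx'
  have e : W.symm (cfc (fun r : ℝ => q ^ 2 + (1 - q ^ 2) * r) R x') = x := by
    rw [hx', ← cfc_apply_mul (by fun_prop) hden]
    have : cfc (fun r : ℝ => (q ^ 2 + (1 - q ^ 2) * r) * (q ^ 2 + (1 - q ^ 2) * r)⁻¹) R = 1 := by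
      rw [← cfc_const_one ℝ R h.isSelfAdjoint]
      exact cfc_congr fun r hr => mul_inv_cancel₀ (moebius_den_pos hq2 (h.spectrum_subset hr)).ne'
    rw [this]
    exact W.symm_apply_apply x
  have e1 := h.apply_symm_den hq x'
  have e2 := h.sqrtMul_symm_den hq x'
  rw [e] at e1 e2
  refine ⟨x', by rw [e1, W.apply_symm_apply], ?_⟩
  rw [e2, map_smul, W.apply_symm_apply, inv_smul_smul₀ (by exact_mod_cast hq.ne')]

theorem exists_zpow (h : IsMoebiusPair q R W) (hq : 0 < q) (n : ℤ) (x : H) :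
    ∃ x', R x' = (W ^ n) (R x) ∧ sqrtMul R x' = (q : ℂ) ^ (-n) • (W ^ n) (sqrtMul R x) := by
  have hq0 : (q : ℂ) ≠ 0 := by exact_mod_cast hq.ne'
  induction n with
  | zero => exact ⟨x, rfl, by simp⟩
  | succ n ih =>
    obtain ⟨y, hy1, hy2⟩ := ih
    obtain ⟨z, hz1, hz2⟩ := h.exists_apply hq y
    have e : ∀ v, (W ^ ((n : ℤ) + 1)) v = W ((W ^ (n : ℤ)) v) := fun v => by
      rw [add_comm, zpow_add, zpow_one]; rfl
    refine ⟨z, by rw [hz1, hy1, e], ?_⟩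
    rw [hz2, hy2, e, map_smul, smul_smul]
    congr 1
    rw [neg_add, zpow_add₀ hq0, zpow_neg_one, mul_comm]
  | pred n ih =>
    obtain ⟨y, hy1, hy2⟩ := ih
    obtain ⟨z, hz1, hz2⟩ := h.exists_symm hq y
    have e : ∀ v, (W ^ (-(n : ℤ) - 1)) v = W.symm ((W ^ (-(n : ℤ))) v) := fun v => by
      rw [sub_eq_add_neg, add_comm, zpow_add, zpow_neg_one]; rfl
    refine ⟨z, by rw [hz1, hy1, e], ?_⟩
    rw [hz2, hy2, e, map_smul, smul_smul]
    congr 1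
    rw [show -(-(n : ℤ) - 1) = 1 + -(-(n : ℤ)) by ring, zpow_add₀ hq0, zpow_one]

/-- Each `W ^ n y` lies where `|ζ| ≤ 1`, while `|ζ| W ^ n y = q^(-n) W ^ n |ζ| y`; hence `‖|ζ| y‖ ≤
q^n ‖y‖` for every `n`. -/
theorem sqrtMul_eq_zero_of_forall_mem (h : IsMoebiusPair q R W) (hq : 0 < q) (hq1 : q < 1) {y : H}
    (hy : ∀ n : ℕ, (W ^ (n : ℤ)) y ∈ cut R) : sqrtMul R y = 0 := by
  obtain ⟨z, hz, -⟩ := exists_of_mem_cut h.nonneg h.le_one (hy 0)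
  replace hz : R z = y := hz
  have key : ∀ n : ℕ, ‖sqrtMul R z‖ ≤ q ^ n * ‖y‖ := by
    intro n
    obtain ⟨u, hu1, hu2⟩ := exists_of_mem_cut h.nonneg h.le_one (hy n)
    obtain ⟨v, hv1, hv2⟩ := h.exists_zpow hq n z
    have huv : v = u := by
      have := h.injective (v - u) (by rw [map_sub, hv1, hu1, hz, sub_self])
      exact sub_eq_zero.1 this
    rw [← huv, hv2, norm_smul, LinearIsometryEquiv.norm_map, LinearIsometryEquiv.norm_map, zpow_neg,
      zpow_natCast, norm_inv, norm_pow, Complex.norm_real, Real.norm_of_nonneg hq.le,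
      inv_mul_le_iff₀ (by positivity)] at hu2
    exact hu2
  have hlim : Filter.Tendsto (fun n : ℕ => q ^ n * ‖y‖) Filter.atTop (nhds 0) := by
    simpa using (tendsto_pow_atTop_nhds_zero_of_lt_one hq.le hq1).mul_const ‖y‖
  have h0 : sqrtMul R z = 0 := norm_le_zero_iff.1 (ge_of_tendsto' hlim key)
  rw [← hz, sqrtMul_comm h.isSelfAdjoint, h0, map_zero]

end IsMoebiusPair

end Scaling

/-! ### The wandering subspace `H₀` and the operator `A`. -/

section Restriction

variable {H : Type*} [NormedAddCommGroup H] [InnerProductSpace ℂ H] [CompleteSpace H]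
  {q : ℝ} {R : H →L[ℂ] H} {W : H ≃ₗᵢ[ℂ] H}

/-- The spectral subspace `cut R ⊖ W⁻¹ (cut R)`. -/
noncomputable def wandering (R : H →L[ℂ] H) (W : H ≃ₗᵢ[ℂ] H) : Submodule ℂ H :=
  cut R ⊓ ((cut R)ᗮ).comap (W.toLinearEquiv : H →ₗ[ℂ] H)

theorem mem_wandering {x : H} : x ∈ wandering R W ↔ x ∈ cut R ∧ W x ∈ (cut R)ᗮ := Iff.rfl

instance (R : H →L[ℂ] H) (W : H ≃ₗᵢ[ℂ] H) : CompleteSpace (wandering R W) := by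
  have : IsClosed (wandering R W : Set H) :=
    (isClosed_cut R).inter ((Submodule.isClosed_orthogonal _).preimage W.continuous)
  exact this.completeSpace_coe

theorem IsMoebiusPair.cfc_mem_wandering (h : IsMoebiusPair q R W) (hq : 0 < q) {f : ℝ → ℝ}
    (hf : ContinuousOn f (Set.Icc 0 1)) {x : H} (hx : x ∈ wandering R W) :
    cfc f R x ∈ wandering R W := by
  rw [mem_wandering] at hx ⊢
  refine ⟨cfc_mem_cut f hx.1, ?_⟩
  rw [h.cfc_conj hq hf]
  exact cfc_mem_cut_orthogonal _ hx.2

theorem IsMoebiusPair.apply_mem_wandering (h : IsMoebiusPair q R W) (hq : 0 < q) {x : H}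
    (hx : x ∈ wandering R W) : R x ∈ wandering R W := by
  have := h.cfc_mem_wandering hq (f := fun r => r) (by fun_prop) hx
  rwa [cfc_id' ℝ R h.isSelfAdjoint] at this

theorem re_inner_lower (h : IsMoebiusPair q R W) {x : H} (hx : x ∈ cut R) :
    1 / 2 * ‖x‖ ^ 2 ≤ RCLike.re ⟪R x, x⟫_ℂ := by
  have h1 := re_inner_nonneg_of_mem_cut (k := fun _ => 1) (T := R) (by fun_prop)
    (fun _ _ => zero_le_one) hx
  have e : (fun r : ℝ => 1 * (r - 1 / 2)) = fun r => -(1 / 2) + 1 * r := by ext r; ring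
  rw [e, cfc_affine h.isSelfAdjoint, inner_add_left, map_add, inner_smul_left, inner_smul_left,
    Complex.conj_ofReal, Complex.conj_ofReal] at h1
  have e1 : RCLike.re (((-(1 / 2) : ℝ) : ℂ) * ⟪x, x⟫_ℂ) = -(1 / 2) * ‖x‖ ^ 2 := by
    rw [← inner_self_eq_norm_sq (𝕜 := ℂ)]
    exact RCLike.re_ofReal_mul _ _
  have e2 : RCLike.re (((1 : ℝ) : ℂ) * ⟪R x, x⟫_ℂ) = RCLike.re ⟪R x, x⟫_ℂ := by simp
  rw [e1, e2] at h1
  linarith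

/-- Being below `1/2` at `W x` means being below `moebius (q ^ 2) (1/2) = 1 / (1 + q²)` at `x`; this
is the bound `|ζ| ≥ q`. -/
theorem re_inner_upper (h : IsMoebiusPair q R W) (hq : 0 < q) {x : H} (hx : W x ∈ (cut R)ᗮ) :
    RCLike.re ⟪R x, x⟫_ℂ ≤ 1 / (1 + q ^ 2) * ‖x‖ ^ 2 := by
  have hq2 : 0 < q ^ 2 := by positivity
  have hsp := h.spectrum_subset
  have hm := h.continuousOn_moebius hq2
  -- The weight is the quotient of `moebius (q ^ 2) r - 1 / (1 + q²)` by `r - 1/2`.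
  have h1 := re_inner_nonpos_of_mem_cut_orthogonal (T := R)
    (k := fun r => 2 * q ^ 2 / ((1 + q ^ 2) * (q ^ 2 + (1 - q ^ 2) * r)))
    (ContinuousOn.div (by fun_prop) (by fun_prop) fun r hr =>
      (mul_pos (by positivity) (moebius_den_pos hq2 (hsp hr))).ne')
    (fun r hr => by have := moebius_den_pos hq2 (hsp hr); positivity) hx
  have e : cfc (fun r => 2 * q ^ 2 / ((1 + q ^ 2) * (q ^ 2 + (1 - q ^ 2) * r)) * (r - 1 / 2)) R =
      cfc (fun r => moebius (q ^ 2) r - 1 / (1 + q ^ 2)) R := by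
    refine cfc_congr fun r hr => ?_
    have hd := (moebius_den_pos hq2 (hsp hr)).ne'
    simp only [moebius]
    have : (1 + q ^ 2) ≠ 0 := by positivity
    generalize hD : q ^ 2 + (1 - q ^ 2) * r = D at *
    field_simp
    rw [← hD]
    ring
  rw [e, cfc_sub _ _ R, cfc_const _ R h.isSelfAdjoint, sub_apply, ← h.intertwine, inner_sub_left,
    map_sub, W.inner_map_map, Algebra.algebraMap_eq_smul_one, smul_apply, re_inner_real_smul,
    one_apply_eq_self, inner_self_eq_norm_sq, W.norm_map] at h1
  linarith

/-- The positive operator `A` with `A² = R⁻¹ - 1`. -/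
theorem exists_modulus_of_bounds {K : Type*} [NormedAddCommGroup K] [InnerProductSpace ℂ K]
    [CompleteSpace K] {R₀ C₀ : K →L[ℂ] K} (hq : 0 < q)
    (hR₀s : ∀ x y, ⟪R₀ x, y⟫_ℂ = ⟪x, R₀ y⟫_ℂ)
    (hR₀l : ∀ x, 1 / 2 * ‖x‖ ^ 2 ≤ RCLike.re ⟪R₀ x, x⟫_ℂ)
    (hR₀u : ∀ x, RCLike.re ⟪R₀ x, x⟫_ℂ ≤ 1 / (1 + q ^ 2) * ‖x‖ ^ 2)
    (hC₀p : 0 ≤ C₀) (hC₀ : ∀ x, C₀ (C₀ x) = R₀ x - R₀ (R₀ x)) :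
    ∃ A : K →L[ℂ] K, IsSelfAdjoint A ∧
      spectrum ℂ A ⊆ Complex.ofReal '' Set.Icc q 1 ∧
      (∀ x, A x = (q : ℂ) • x → (q : ℂ) ^ 2 • R₀ x = x - R₀ x) ∧
      ∀ x, ∃ z, R₀ z = x ∧ C₀ z = A x := by
  have hq2 : 0 < q ^ 2 := by positivity
  have halg : ∀ (c : ℝ) (x : K),
      RCLike.re ⟪(algebraMap ℝ (K →L[ℂ] K) c) x, x⟫_ℂ = c * ‖x‖ ^ 2 := by
    intro c x
    rw [Algebra.algebraMap_eq_smul_one, smul_apply, re_inner_real_smul, one_apply_eq_self,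
      inner_self_eq_norm_sq]
  have halgs : ∀ (c : ℝ) (x y : K),
      ⟪(algebraMap ℝ (K →L[ℂ] K) c) x, y⟫_ℂ =
        ⟪x, (algebraMap ℝ (K →L[ℂ] K) c) y⟫_ℂ := by
    intro c x y
    simp [Algebra.algebraMap_eq_smul_one]
  have hlow : algebraMap ℝ _ (1 / 2) ≤ R₀ := by
    rw [← sub_nonneg]
    refine nonneg_of_symm (fun x y => ?_) fun x => ?_
    · rw [sub_apply, sub_apply, inner_sub_left, inner_sub_right, hR₀s, halgs]
    · rw [sub_apply, inner_sub_left, map_sub, halg, sub_nonneg]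
      exact hR₀l x
  have hup : R₀ ≤ algebraMap ℝ _ (1 / (1 + q ^ 2)) := by
    rw [← sub_nonneg]
    refine nonneg_of_symm (fun x y => ?_) fun x => ?_
    · rw [sub_apply, sub_apply, inner_sub_left, inner_sub_right, hR₀s, halgs]
    · rw [sub_apply, inner_sub_left, map_sub, halg, sub_nonneg]
      exact hR₀u x
  have hR₀n : 0 ≤ R₀ := le_trans (by
    exact nonneg_of_symm (halgs _) fun x => by rw [halg]; positivity) hlow
  have hR₀sa := IsSelfAdjoint.of_nonneg hR₀n
  have hsp : spectrum ℝ R₀ ⊆ Set.Icc (1 / 2) (1 / (1 + q ^ 2)) := fun r hr =>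
    ⟨(algebraMap_le_iff_le_spectrum hR₀sa).1 hlow r hr,
      (le_algebraMap_iff_spectrum_le hR₀sa).1 hup r hr⟩
  have hpos : ∀ r ∈ spectrum ℝ R₀, 0 < r := fun r hr => by linarith [(hsp hr).1]
  have hle1 : ∀ r ∈ spectrum ℝ R₀, r ≤ 1 := fun r hr => (hsp hr).2.trans (by
    rw [div_le_one (by positivity)]; linarith)
  have hR₀1 : R₀ ≤ 1 := (CFC.le_one_iff (R := ℝ) R₀ hR₀sa).2 hle1
  have hψ : ContinuousOn (fun r : ℝ => √((1 - r) / r)) (spectrum ℝ R₀) :=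
    (ContinuousOn.div (by fun_prop) (by fun_prop) fun r hr => (hpos r hr).ne').sqrt
  -- At `r = 1 / (1 + t)` the function is `√t`; it carries `[1/2, 1 / (1 + q²)]` to `[q, 1]`.
  set A := cfc (fun r : ℝ => √((1 - r) / r)) R₀ with hA
  have hAsa : IsSelfAdjoint A := cfc_predicate _ _
  have hC₀eq : C₀ = sqrtMul R₀ := by
    rw [← CFC.mul_self_eq_mul_self_iff C₀ _ hC₀p (sqrtMul_nonneg R₀)]
    ext x
    rw [mul_apply_eq_comp, mul_apply_eq_comp, sqrtMul_sqrtMul hR₀n hR₀1]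
    exact hC₀ x
  have hAR : ∀ x, A (R₀ x) = C₀ x := fun x => by
    have e := cfc_apply_mul (T := R₀) hψ (g := fun r => r) (by fun_prop) x
    rw [cfc_id' ℝ R₀] at e
    rw [← e, hC₀eq, sqrtMul]
    refine congrArg (fun T : K →L[ℂ] K => T x) (cfc_congr fun r hr => ?_)
    have h0 := hpos r hr
    have h1 := hle1 r hr
    have e1 : √(r ^ 2) = r := Real.sqrt_sq h0.le
    have e2 : (1 - r) / r * r ^ 2 = r * (1 - r) := by field_simp
    calc √((1 - r) / r) * r = √((1 - r) / r) * √(r ^ 2) := by rw [e1]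
      _ = √(r * (1 - r)) := by
        rw [← Real.sqrt_mul (div_nonneg (by linarith) h0.le), e2]
  have hAAR : ∀ x, A (A (R₀ x)) = x - R₀ x := fun x => by
    have e := cfc_apply_mul (T := R₀) (hψ.mul hψ) (g := fun r => r) (by fun_prop) x
    have e' := cfc_apply_mul (T := R₀) hψ hψ (R₀ x)
    rw [cfc_id' ℝ R₀] at e
    rw [hA, ← e']
    refine e.symm.trans ?_
    have : cfc (fun r => √((1 - r) / r) * √((1 - r) / r) * r) R₀ =
        cfc (fun r : ℝ => 1 + (-1) * r) R₀ := by
      refine cfc_congr fun r hr => ?_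
      have h0 := hpos r hr
      have h1 := hle1 r hr
      change √((1 - r) / r) * √((1 - r) / r) * r = 1 + (-1) * r
      rw [Real.mul_self_sqrt (div_nonneg (by linarith) h0.le), div_mul_cancel₀ _ h0.ne']
      ring
    refine (congrArg (fun T : K →L[ℂ] K => T x) this).trans ?_
    rw [cfc_affine hR₀sa]
    simp [sub_eq_add_neg]
  refine ⟨A, hAsa, ?_, ?_, ?_⟩
  · rw [← hAsa.spectrumRestricts.algebraMap_image, hA, cfc_map_spectrum _ R₀ hR₀sa hψ]
    rintro _ ⟨_, ⟨r, hr, rfl⟩, rfl⟩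
    refine ⟨_, ⟨?_, ?_⟩, rfl⟩
    · have h0 := hpos r hr
      have h2 := (hsp hr).2
      rw [le_div_iff₀ (by positivity)] at h2
      refine Real.le_sqrt_of_sq_le ?_
      rw [le_div_iff₀ h0]
      linarith
    · have h0 := hpos r hr
      have h2 := (hsp hr).1
      refine Real.sqrt_le_iff.2 ⟨zero_le_one, ?_⟩
      rw [one_pow, div_le_one h0]
      linarith
  · intro x hx
    have hcomm : ∀ y, A (R₀ y) = R₀ (A y) := cfc_comm_self hR₀sa _
    rw [← hAAR, hcomm, hx, map_smul, map_smul, hcomm, hx, map_smul, smul_smul, pow_two]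
  · intro x
    have hc : ContinuousOn (fun r : ℝ => r⁻¹) (spectrum ℝ R₀) :=
      ContinuousOn.inv₀ (by fun_prop) fun r hr => (hpos r hr).ne'
    set z := cfc (fun r : ℝ => r⁻¹) R₀ x with hz
    have e : R₀ z = x := by
      have e1 := cfc_apply_mul (T := R₀) (f := fun r => r) (by fun_prop) hc x
      rw [cfc_id' ℝ R₀] at e1
      rw [hz, ← e1]
      have : cfc (fun r : ℝ => r * r⁻¹) R₀ = 1 := by
        rw [← cfc_const_one ℝ R₀]
        exact cfc_congr fun r hr => mul_inv_cancel₀ (hpos r hr).ne'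
      rw [this]
      rfl
    refine ⟨z, e, ?_⟩
    rw [← e, hAR]

theorem IsMoebiusPair.exists_modulus (h : IsMoebiusPair q R W) (hq : 0 < q) :
    ∃ A : wandering R W →L[ℂ] wandering R W, IsSelfAdjoint A ∧
      spectrum ℂ A ⊆ Complex.ofReal '' Set.Icc q 1 ∧
      (∀ x, A x = (q : ℂ) • x → x = 0) ∧
      ∀ x : wandering R W, ∃ z : H, R z = x ∧ sqrtMul R z = A x := by
  have hsa := h.isSelfAdjoint
  have hRm : ∀ x ∈ wandering R W, R x ∈ wandering R W := fun x => h.apply_mem_wandering hq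
  have hCm : ∀ x ∈ wandering R W, sqrtMul R x ∈ wandering R W := fun x =>
    h.cfc_mem_wandering hq (by fun_prop)
  obtain ⟨A, hA, hsp, hev, hz⟩ := exists_modulus_of_bounds (R₀ := R.restrict hRm)
    (C₀ := (sqrtMul R).restrict hCm) hq (fun x y => hsa.isSymmetric (x : H) y)
    (fun x => re_inner_lower h x.2.1) (fun x => re_inner_upper h hq x.2.2)
    (nonneg_of_symm (fun x y => cfc_symm _ R (x : H) y)
      fun x => re_inner_nonneg (sqrtMul_nonneg R) (x : H))
    (fun x => Subtype.ext (sqrtMul_sqrtMul h.nonneg h.le_one (x : H)))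
  refine ⟨A, hA, hsp, fun x hx => ?_, fun x => ?_⟩
  -- An eigenvector for `q` would give `R (W x) = W x / 2`, placing `W x` in the cut as well as in
  -- its complement.
  · have e2 : (q : ℂ) ^ 2 • R x = x - R x := congrArg Subtype.val (hev x hx)
    set u := W x with hu
    have e3 : (q : ℂ) ^ 2 • cfc (moebius (q ^ 2)) R u = u - cfc (moebius (q ^ 2)) R u := by
      rw [hu, ← h.intertwine, ← map_smul, e2, map_sub]
    have e4 := congrArg (cfc (fun r : ℝ => q ^ 2 + (1 - q ^ 2) * r) R : H →L[ℂ] H) e3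
    rw [map_smul, map_sub, cfc_apply_comm, h.cfc_moebius_den hq, cfc_affine hsa] at e4
    have e5 : (q : ℂ) ^ 2 • ((2 : ℂ) • R u - u) = 0 := by
      push_cast at e4
      have := sub_eq_zero.2 e4
      rw [← this]
      module
    have hq0 : (q : ℂ) ^ 2 ≠ 0 := pow_ne_zero _ (by exact_mod_cast hq.ne')
    have e6 : (2 : ℂ) • R u = u := sub_eq_zero.1 ((smul_eq_zero.1 e5).resolve_left hq0)
    have hcut : u ∈ cut R := by
      rw [mem_cut, ← norm_le_zero_iff]
      have hn := norm_cfc_apply_mono (T := R) (f := fun r => max (1 / 2 - r) 0)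
        (g := fun r => -1 + 2 * r) (by fun_prop) (by fun_prop) (fun r hr => ?_) u
      · rw [cfc_affine hsa] at hn
        push_cast at hn
        rw [e6, neg_one_smul, neg_add_cancel, norm_zero] at hn
        exact hn
      · rw [abs_of_nonneg (le_max_right _ _)]
        refine max_le ?_ (abs_nonneg _)
        rcases le_total (1 / 2 - r) 0 with h3 | h3
        · exact h3.trans (abs_nonneg _)
        · exact le_trans (by linarith) (neg_le_abs (-1 + 2 * r))
    have hu0 : u = 0 := by
      have := (Submodule.mem_orthogonal _ _).1 x.2.2 u hcut
      exact inner_self_eq_zero.1 this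
    have : (x : H) = 0 := W.injective (by rw [map_zero]; exact hu0)
    exact Subtype.ext this
  · obtain ⟨z, hz1, hz2⟩ := hz x
    exact ⟨z, congrArg Subtype.val hz1, congrArg Subtype.val hz2⟩

end Restriction

/-! ### Decomposition of the space into the kernel and the translates of `H₀`. -/

section Decomposition

variable {H : Type*} [NormedAddCommGroup H] [InnerProductSpace ℂ H]

/-- Orthogonality to every gap `N n ⊖ N (n + 1)` makes the projections of `x` onto consecutive
members of the chain agree; `z` is their common value. -/
theorem exists_mem_sub_mem_orthogonal {N : ℤ → Submodule ℂ H} [∀ n, CompleteSpace (N n)]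
    (hN : ∀ n, N (n + 1) ≤ N n) {x : H}
    (hx : ∀ n, ∀ d ∈ N n, d ∈ (N (n + 1))ᗮ → ⟪d, x⟫_ℂ = 0) :
    ∃ z, ∀ n, z ∈ N n ∧ x - z ∈ (N n)ᗮ := by
  have key : ∀ n, (N n).starProjection x = (N (n + 1)).starProjection x := by
    intro n
    set a := (N n).starProjection x with ha
    set b := (N (n + 1)).starProjection x with hb
    have ham : a ∈ N n := (N n).starProjection_apply_mem x
    have hbm : b ∈ N (n + 1) := (N (n + 1)).starProjection_apply_mem x
    have hao : x - a ∈ (N n)ᗮ := (N n).sub_starProjection_mem_orthogonal x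
    have hbo : x - b ∈ (N (n + 1))ᗮ := (N (n + 1)).sub_starProjection_mem_orthogonal x
    have hd : a - b ∈ N n := (N n).sub_mem ham (hN n hbm)
    have hdo : a - b ∈ (N (n + 1))ᗮ := by
      have := (N (n + 1))ᗮ.sub_mem hbo (Submodule.orthogonal_le (hN n) hao)
      rwa [sub_sub_sub_cancel_left] at this
    have h1 := hx n _ hd hdo
    have h2 : ⟪a - b, x - a⟫_ℂ = 0 := (Submodule.mem_orthogonal _ _).1 hao _ hd
    have h3 : ⟪a - b, b⟫_ℂ = 0 := (Submodule.mem_orthogonal' _ _).1 hdo _ hbm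
    have h4 : ⟪a - b, a - b⟫_ℂ = 0 := by
      rw [inner_sub_right] at h2 ⊢
      rw [h3, ← sub_eq_zero.1 h2, h1, sub_zero]
    exact sub_eq_zero.1 (inner_self_eq_zero.1 h4)
  have hall : ∀ n, (N n).starProjection x = (N 0).starProjection x := by
    intro n
    induction n with
    | zero => rfl
    | succ n ih => rw [← key, ih]
    | pred n ih => rw [key, sub_add_cancel, ih]
  refine ⟨(N 0).starProjection x, fun n => ?_⟩
  rw [← hall n]
  exact ⟨(N n).starProjection_apply_mem x, (N n).sub_starProjection_mem_orthogonal x⟩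

theorem zpow_apply_zpow (W : H ≃ₗᵢ[ℂ] H) (m n : ℤ) (x : H) :
    (W ^ m) ((W ^ n) x) = (W ^ (m + n)) x := by
  rw [zpow_add]
  rfl

theorem inner_zpow_left (W : H ≃ₗᵢ[ℂ] H) (n : ℤ) (x y : H) :
    ⟪(W ^ n) x, y⟫_ℂ = ⟪x, (W ^ (-n)) y⟫_ℂ := by
  rw [← (W ^ (-n)).inner_map_map, zpow_apply_zpow, neg_add_cancel]
  rfl

theorem zpow_apply_of_fixed {W : H ≃ₗᵢ[ℂ] H} {x : H} (hx : W x = x) (n : ℤ) : (W ^ n) x = x := by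
  have h1 : (W ^ (1 : ℤ)) x = x := by rwa [zpow_one]
  have h2 : (W ^ (-1 : ℤ)) x = x := by
    conv_lhs => rw [← h1, zpow_apply_zpow]
    rfl
  induction n with
  | zero => rfl
  | succ n ih => rw [← zpow_apply_zpow, h1, ih]
  | pred n ih => rw [sub_eq_add_neg, ← zpow_apply_zpow, h2, ih]

variable [CompleteSpace H] {q : ℝ} {R : H →L[ℂ] H} {W : H ≃ₗᵢ[ℂ] H}

namespace IsMoebiusPair

theorem zpow_neg_mem_cut (h : IsMoebiusPair q R W) (hq : 0 < q) (hq1 : q < 1) {x : H}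
    (hx : x ∈ cut R) (n : ℕ) : (W ^ (-(n : ℤ))) x ∈ cut R := by
  induction n with
  | zero => exact hx
  | succ n ih =>
    apply h.mem_cut_of_apply hq hq1
    have : W ((W ^ (-((n + 1 : ℕ) : ℤ))) x) = (W ^ (-(n : ℤ))) x := by
      have := zpow_apply_zpow W 1 (-((n + 1 : ℕ) : ℤ)) x
      rw [zpow_one] at this
      rw [this]
      congr 2
      push_cast
      ring
    rwa [this]

/-- Completeness of the translates modulo the kernel. The chain is `W^(-n) (cut R)`, with gaps
`W^(-n)` of the wandering subspace; `z` is handled by `n → ∞` and `x - z` by `n → -∞`. -/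
theorem sqrtMul_eq_zero_of_forall_inner (h : IsMoebiusPair q R W) (hq : 0 < q) (hq1 : q < 1)
    {x : H} (hx : ∀ n : ℤ, ∀ y ∈ wandering R W, ⟪(W ^ (-n)) y, x⟫_ℂ = 0) : sqrtMul R x = 0 := by
  let N : ℤ → Submodule ℂ H := fun n => (cut R).comap ((W ^ n).toLinearEquiv : H →ₗ[ℂ] H)
  have hmem : ∀ n v, v ∈ N n ↔ (W ^ n) v ∈ cut R := fun _ _ => Iff.rfl
  have hcl : ∀ n, CompleteSpace (N n) := fun n =>
    ((isClosed_cut R).preimage (W ^ n).continuous).completeSpace_coe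
  have horth : ∀ n v, v ∈ (N n)ᗮ → (W ^ n) v ∈ (cut R)ᗮ := by
    intro n v hv
    rw [Submodule.mem_orthogonal'] at hv ⊢
    intro u hu
    rw [inner_zpow_left]
    refine hv _ ((hmem _ _).2 ?_)
    rw [zpow_apply_zpow, add_neg_cancel]
    exact hu
  have hW1 : ∀ (n : ℤ) v, W ((W ^ n) v) = (W ^ (n + 1)) v := fun n v => by
    have := zpow_apply_zpow W 1 n v
    rwa [zpow_one, add_comm] at this
  obtain ⟨z, hz⟩ := exists_mem_sub_mem_orthogonal (N := N) (fun n v hv => by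
      rw [hmem, ← hW1] at hv
      exact h.mem_cut_of_apply hq hq1 hv) (x := x) (fun n d hd hdo => by
      have := hx n ((W ^ n) d) ⟨hd, by
        change W ((W ^ n) d) ∈ (cut R)ᗮ
        rw [hW1]
        exact horth _ _ hdo⟩
      rw [zpow_apply_zpow, neg_add_cancel] at this
      exact this)
  have h1 : sqrtMul R z = 0 :=
    h.sqrtMul_eq_zero_of_forall_mem hq hq1 fun n => (hz n).1
  have h2 : x - z = 0 := by
    refine h.eq_zero_of_forall_mem_orthogonal hq hq1
      (y := fun n => (W ^ (-(n : ℤ))) (x - z)) (fun n => ?_) fun n => horth _ _ (hz _).2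
    rw [← zpow_natCast, zpow_apply_zpow, add_neg_cancel]
    rfl
  rwa [sub_eq_zero.1 h2]

theorem orthogonalFamily (h : IsMoebiusPair q R W) (hq : 0 < q) (hq1 : q < 1) :
    OrthogonalFamily ℂ (fun _ : ℤ => wandering R W) fun n =>
      (W ^ (-n)).toLinearIsometry.comp (wandering R W).subtypeₗᵢ := by
  have key : ∀ m n : ℤ, m < n → ∀ u v : wandering R W,
      ⟪(W ^ (-m)) u, (W ^ (-n)) v⟫_ℂ = 0 := by
    intro m n hmn u v
    -- One extra application of `W` takes `u` out of the cut, while `v` is moved by the nonpositive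
    -- power `1 + m - n` and stays in it.
    obtain ⟨k, hk⟩ : ∃ k : ℕ, -(k : ℤ) = 1 + (m + -n) := ⟨(n - m - 1).toNat, by omega⟩
    rw [inner_zpow_left, neg_neg, zpow_apply_zpow, ← W.inner_map_map]
    have := zpow_apply_zpow W 1 (m + -n) v
    rw [zpow_one] at this
    rw [this, ← hk]
    exact (Submodule.mem_orthogonal' _ _).1 u.2.2 _ (h.zpow_neg_mem_cut hq hq1 v.2.1 k)
  intro m n hmn u v
  rcases lt_or_gt_of_ne hmn with hlt | hlt
  · exact key m n hlt u v
  · exact inner_eq_zero_symm.1 (key n m hlt v u)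

end IsMoebiusPair

theorem exists_decomposition (h : IsMoebiusPair q R W) (hq : 0 < q) (hq1 : q < 1)
    {K : Submodule ℂ H} (hK : ∀ x, x ∈ K ↔ sqrtMul R x = 0) (hKR : ∀ x ∈ K, R x = x)
    (hKW : ∀ x ∈ K, W x = x) :
    ∃ U : H ≃ₗᵢ[ℂ] Space K (wandering R W), (∀ k : K, U (k : H) = WithLp.toLp 2 (k, 0)) ∧
      ∀ (n : ℤ) (y : wandering R W), U.symm (single K n y) = (W ^ (-n)) y := by
  have hV := h.orthogonalFamily hq hq1
  have hKc : IsClosed (K : Set H) := by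
    have : (K : Set H) = {x | sqrtMul R x = 0} := Set.ext hK
    rw [this]
    exact isClosed_eq (sqrtMul R).continuous continuous_const
  have : CompleteSpace K := hKc.completeSpace_coe
  have hKV : ∀ k ∈ K, ∀ (n : ℤ) (y : wandering R W), ⟪k, (W ^ (-n)) y⟫_ℂ = 0 := by
    intro k hk n y
    have e := inner_zpow_left W n k y
    rw [zpow_apply_of_fixed (hKW k hk)] at e
    rw [← e, ← W.inner_map_map, hKW k hk]
    exact (Submodule.mem_orthogonal _ _).1 y.2.2 _ (mem_cut_of_fixed h.nonneg h.le_one (hKR k hk))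
  have hKJ : ∀ k ∈ K, ∀ v, ⟪k, hV.linearIsometry v⟫_ℂ = 0 := by
    intro k hk v
    have h1 := (hV.hasSum_linearIsometry v).mapL (innerSL ℂ k)
    have h2 : HasSum (fun n : ℤ => (innerSL ℂ k) ((W ^ (-n)) (v n))) 0 := by
      simp only [innerSL_apply_apply, hKV k hk]
      exact hasSum_zero
    exact h1.unique h2
  let L : Space K (wandering R W) →ₗᵢ[ℂ] H :=
    { toFun := fun s => (s.fst : H) + hV.linearIsometry s.snd
      map_add' := fun s t => by
        simp only [WithLp.add_fst, WithLp.add_snd, map_add, Submodule.coe_add]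
        abel
      map_smul' := fun c s => by
        simp only [WithLp.smul_fst, WithLp.smul_snd, map_smul, Submodule.coe_smul, smul_add,
          RingHom.id_apply]
      norm_map' := fun s => by
        have e := norm_add_sq_eq_norm_sq_add_norm_sq_of_inner_eq_zero _ _
          (hKJ s.fst s.fst.2 s.snd)
        rw [← sq_eq_sq₀ (norm_nonneg _) (norm_nonneg _), WithLp.prod_norm_sq_eq_of_L2]
        change ‖(s.fst : H) + hV.linearIsometry s.snd‖ ^ 2 = _
        rw [pow_two, e, LinearIsometry.norm_map, pow_two, pow_two]
        rfl }
  have hLs : ∀ (n : ℤ) (y : wandering R W), L (single K n y) = (W ^ (-n)) y := by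
    intro n y
    change ((0 : K) : H) + hV.linearIsometry (lp.single 2 n y) = _
    rw [hV.linearIsometry_apply_single, Submodule.coe_zero, zero_add]
    rfl
  have hLk : ∀ k : K, L (WithLp.toLp 2 (k, 0)) = k := by
    intro k
    change (k : H) + hV.linearIsometry 0 = k
    rw [map_zero, add_zero]
  have hsurj : Function.Surjective L := by
    have hcl : IsClosed (L.toLinearMap.range : Set H) := by
      rw [LinearMap.coe_range]
      exact L.isometry.isClosedEmbedding.isClosed_range
    have : CompleteSpace L.toLinearMap.range := hcl.completeSpace_coe
    rw [← LinearIsometry.coe_toLinearMap, ← LinearMap.range_eq_top,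
      ← Submodule.orthogonal_eq_bot_iff, Submodule.eq_bot_iff]
    intro x hx
    rw [Submodule.mem_orthogonal] at hx
    have h1 : x ∈ K := by
      rw [hK]
      refine h.sqrtMul_eq_zero_of_forall_inner hq hq1 fun n y hy => ?_
      rw [← hLs n ⟨y, hy⟩]
      exact hx _ ⟨_, rfl⟩
    have h2 := hx _ ⟨WithLp.toLp 2 ((⟨x, h1⟩ : K), 0), rfl⟩
    change ⟪L (WithLp.toLp 2 ((⟨x, h1⟩ : K), 0)), x⟫_ℂ = 0 at h2
    rw [hLk] at h2
    exact inner_self_eq_zero.1 h2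
  let e := LinearIsometryEquiv.ofSurjective L hsurj
  refine ⟨e.symm, fun k => ?_, hLs⟩
  rw [LinearIsometryEquiv.symm_apply_eq]
  exact (hLk k).symm

end Decomposition

/-! ### Coordinates in the direct sum. -/

section ModelSpace

universe u

variable {K H₀ : Type u} [NormedAddCommGroup H₀]

theorem space_ext {s t : Space K H₀} (h₁ : s.fst = t.fst) (h₂ : ∀ n, s.snd n = t.snd n) : s = t :=
  WithLp.ofLp_injective 2 (Prod.ext h₁ (lp.ext (funext h₂)))

variable [NormedAddCommGroup K]

theorem single_snd (n m : ℤ) (h : H₀) : (single K n h).snd m = if m = n then h else 0 := by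
  simp only [single]
  rcases eq_or_ne m n with rfl | hmn
  · simp
  · simp [hmn]

variable [InnerProductSpace ℂ K] [InnerProductSpace ℂ H₀]

theorem inner_single_left (n : ℤ) (h : H₀) (s : Space K H₀) :
    ⟪single K n h, s⟫_ℂ = ⟪h, s.snd n⟫_ℂ := by
  rw [WithLp.prod_inner_apply]
  simp [single, lp.inner_single_left]

theorem inner_toLp_left (k : K) (s : Space K H₀) :
    ⟪(WithLp.toLp 2 (k, 0) : Space K H₀), s⟫_ℂ = ⟪k, s.fst⟫_ℂ := by
  rw [WithLp.prod_inner_apply]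
  simp

theorem smul_single (c : ℂ) (n : ℤ) (h : H₀) : c • single K n h = single K n (c • h) := by
  refine space_ext (by simp [single]) fun m => ?_
  simp [single]

theorem hasSum_single (v : lp (fun _ : ℤ => H₀) 2) :
    HasSum (fun n => single K n (v n)) (WithLp.toLp 2 (0, v)) := by
  have h := lp.hasSum_single (p := 2) (by norm_num) v
  let F : lp (fun _ : ℤ => H₀) 2 →L[ℂ] Space K H₀ :=
    ((WithLp.prodContinuousLinearEquiv 2 ℂ K (lp (fun _ : ℤ => H₀) 2)).symm : _ →L[ℂ] _) ∘L
      ContinuousLinearMap.inr ℂ K (lp (fun _ : ℤ => H₀) 2)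
  exact h.mapL F

variable {H : Type*} [NormedAddCommGroup H] [InnerProductSpace ℂ H]

theorem inner_symm_left (U : H ≃ₗᵢ[ℂ] Space K H₀) (s : Space K H₀) (x : H) :
    ⟪U.symm s, x⟫_ℂ = ⟪s, U x⟫_ℂ := by
  rw [← U.inner_map_map, U.apply_symm_apply]

theorem hasSum_symm_single (U : H ≃ₗᵢ[ℂ] Space K H₀) (v : lp (fun _ : ℤ => H₀) 2) :
    HasSum (fun n => U.symm (single K n (v n))) (U.symm (WithLp.toLp 2 (0, v))) :=
  (hasSum_single v).mapL (U.symm.toContinuousLinearEquiv : Space K H₀ →L[ℂ] H)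

end ModelSpace

/-! ### Identification of `ζ` with the maximal weighted shift. -/

section Equivalence

variable {H : Type*} [NormedAddCommGroup H] [InnerProductSpace ℂ H]
  {q : ℝ} {ζ : H →ₗ.[ℂ] H} {H₀ : Type _} [NormedAddCommGroup H₀] [InnerProductSpace ℂ H₀]
  {A : H₀ →L[ℂ] H₀} {U : H ≃ₗᵢ[ℂ] Space (ker ζ) H₀}

/-- Finite truncations of `x` and of its formal image converge, and the graph is closed. -/
theorem mem_graph_of_shift_eq (hc : ζ.IsClosed)
    (hUk : ∀ k : ker ζ, U (k : H) = WithLp.toLp 2 (k, 0))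
    (hUs : ∀ (n : ℤ) (h : H₀), (U.symm (single _ n h),
      (q : ℂ) ^ n • U.symm (single _ (n - 1) (A h))) ∈ ζ.graph)
    {x : H} {v : lp (fun _ : ℤ => H₀) 2} (hv : ∀ n, v n = shift q A (U x) n) :
    (x, U.symm (WithLp.toLp 2 (0, v))) ∈ ζ.graph := by
  have h1 := hasSum_symm_single U (U x).snd
  have h2 := hasSum_symm_single U v
  -- The image of the `n`-th component sits in slot `n - 1`; reindexing pairs the two series term by
  -- term.
  rw [← (Equiv.subRight (1 : ℤ)).hasSum_iff] at h2
  have h3 := h1.prodMk h2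
  have h4 : (U.symm (WithLp.toLp 2 (0, (U x).snd)), U.symm (WithLp.toLp 2 (0, v))) ∈ ζ.graph := by
    refine hc.mem_of_tendsto h3 (Filter.Eventually.of_forall fun F => ?_)
    refine ζ.graph.sum_mem fun n _ => ?_
    have := hUs n ((U x).snd n)
    convert this using 2
    change U.symm (single (ker ζ) (n - 1) (v (n - 1))) = _
    rw [hv, ← map_smul, smul_single, shift, sub_add_cancel]
  have h5 := ζ.graph.add_mem (mem_ker_iff.1 (U x).fst.2) h4
  rw [Prod.mk_add_mk, zero_add] at h5
  convert h5 using 2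
  rw [← (LinearIsometryEquiv.symm_apply_eq U).2 (hUk _).symm, ← map_add,
    eq_comm, LinearIsometryEquiv.symm_apply_eq]
  exact space_ext (by simp) (by simp)

variable [CompleteSpace H] [CompleteSpace H₀]

/-- Once `h_m` is known to lie in `dom ζ*`, the value of `ζ*` there is read off by pairing with `ker
ζ` and all the vectors `g_n`. -/
theorem mem_adjoint_graph_single (hζ : IsQNormal q ζ) (hA : IsSelfAdjoint A)
    (hUk : ∀ k : ker ζ, U (k : H) = WithLp.toLp 2 (k, 0))
    (hUs : ∀ (n : ℤ) (h : H₀), (U.symm (single _ n h),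
      (q : ℂ) ^ n • U.symm (single _ (n - 1) (A h))) ∈ ζ.graph)
    (hUd : ∀ (n : ℤ) (h : H₀), ∃ w, (U.symm (single _ n h), w) ∈ ζ.adjoint.graph)
    (m : ℤ) (h : H₀) : (U.symm (single _ m h),
      (q : ℂ) ^ (m + 1) • U.symm (single _ (m + 1) (A h))) ∈ ζ.adjoint.graph := by
  have hd := hζ.dense_domain
  obtain ⟨w, hw⟩ := hUd m h
  suffices hw' : w = (q : ℂ) ^ (m + 1) • U.symm (single _ (m + 1) (A h)) by rwa [← hw']
  rw [← map_smul, ← LinearIsometryEquiv.symm_apply_apply U w]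
  congr 1
  refine space_ext ?_ fun n => ?_
  · refine ext_inner_left ℂ fun k => ?_
    have h1 := inner_eq_of_mem_graph_adjoint hd (mem_ker_iff.1 k.2) hw
    rw [inner_zero_left] at h1
    rw [← inner_toLp_left, ← hUk, U.inner_map_map, ← h1, smul_single]
    simp [single]
  · refine ext_inner_left ℂ fun g => ?_
    have h1 := inner_eq_of_mem_graph_adjoint hd (hUs n g) hw
    rw [← inner_single_left, ← inner_symm_left, ← h1, inner_smul_left, inner_symm_left,
      U.apply_symm_apply, inner_single_left, single_snd, smul_single, single_snd]
    rcases eq_or_ne n (m + 1) with rfl | hne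
    · have hAs : ⟪A g, h⟫_ℂ = ⟪g, A h⟫_ℂ := hA.isSymmetric g h
      rw [if_pos (by ring), if_pos rfl, inner_smul_right, ← hAs, map_zpow₀, Complex.conj_ofReal]
    · rw [if_neg (by omega), if_neg hne, inner_zero_right, inner_zero_right, mul_zero]

/-- The components of `ζ x` are its inner products with vectors of `dom ζ*`, so moving `ζ` across
computes them with no convergence argument. -/
theorem apply_eq_shift (hζ : IsQNormal q ζ) (hq : q ≠ 0) (hA : IsSelfAdjoint A)
    (hUk : ∀ k : ker ζ, U (k : H) = WithLp.toLp 2 (k, 0))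
    (hUa : ∀ (m : ℤ) (h : H₀), (U.symm (single _ m h),
      (q : ℂ) ^ (m + 1) • U.symm (single _ (m + 1) (A h))) ∈ ζ.adjoint.graph)
    {x y : H} (hxy : (x, y) ∈ ζ.graph) :
    (U y).fst = 0 ∧ ∀ m, (U y).snd m = shift q A (U x) m := by
  have hd := hζ.dense_domain
  constructor
  · refine ext_inner_left ℂ fun k => ?_
    have h1 := inner_eq_of_mem_graph_adjoint hd hxy ((hζ.mem_ker_iff_adjoint hq).1 k.2)
    rw [inner_zero_right] at h1
    rw [← inner_toLp_left, ← hUk, U.inner_map_map, inner_zero_right, inner_eq_zero_symm]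
    exact h1
  · intro m
    refine ext_inner_right ℂ fun h => ?_
    have h1 := inner_eq_of_mem_graph_adjoint hd hxy (hUa m h)
    rw [← inner_conj_symm, ← inner_single_left, ← inner_symm_left, inner_conj_symm, h1,
      inner_smul_right, ← inner_conj_symm, inner_symm_left, inner_single_left, inner_conj_symm,
      shift, inner_smul_left, map_zpow₀, Complex.conj_ofReal]
    congr 1
    exact (hA.isSymmetric _ _).symm

end Equivalence

theorem eq_zero_of_ker_eq_top {E : Type*} [AddCommGroup E] [Module ℂ E] {ζ : E →ₗ.[ℂ] E}
    (h : ∀ x, x ∈ ker ζ) : ζ = 0 := by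
  refine LinearPMap.eq_of_eq_graph (Submodule.ext fun ⟨x, y⟩ => ?_)
  have hx := mem_ker_iff.1 (h x)
  constructor
  · intro hxy
    obtain rfl := ζ.mem_graph_snd_inj hxy hx rfl
    exact (LinearPMap.mem_graph_iff _).2 ⟨⟨x, trivial⟩, rfl, rfl⟩
  · intro hxy
    obtain ⟨u, rfl, rfl⟩ := (LinearPMap.mem_graph_iff _).1 hxy
    exact hx

end QNormal

/-! ### Assembly of the structure theorem. -/

theorem corollary2p1 {H : Type*} [NormedAddCommGroup H] [InnerProductSpace ℂ H] [CompleteSpace H]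
    (q : ℝ) (hq0 : 0 < q) (hq1 : q < 1)
    (ζ : H →ₗ.[ℂ] H) (hζ : QNormal.IsQNormal q ζ) (hne : ζ ≠ 0) :
    ∃ (H₀ : Type _) (_ : NormedAddCommGroup H₀) (_ : InnerProductSpace ℂ H₀)
      (_ : CompleteSpace H₀) (A : H₀ →L[ℂ] H₀)
      (U : H ≃ₗᵢ[ℂ] QNormal.Space (QNormal.ker ζ) H₀),
      Nontrivial H₀ ∧
      -- `A` is self-adjoint, `spec A ⊆ [q, 1]`, and `q` is not an eigenvalue
      IsSelfAdjoint A ∧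
      spectrum ℂ A ⊆ Complex.ofReal '' Set.Icc q 1 ∧
      ¬ Module.End.HasEigenvalue (A : H₀ →ₗ[ℂ] H₀) (q : ℂ) ∧
      -- the first summand is the subspace `ker ζ` of `H` itself
      (∀ k : QNormal.ker ζ, U (k : H) = WithLp.toLp 2 (k, 0)) ∧
      -- `ζ h_n = q^n (A h)_{n-1}`
      (∀ (n : ℤ) (h : H₀), ∃ hn : U.symm (QNormal.single _ n h) ∈ ζ.domain,
        U (ζ ⟨U.symm (QNormal.single _ n h), hn⟩) =
          ((q : ℂ) ^ n) • QNormal.single _ (n - 1) (A h)) ∧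
      -- these formulas determine `ζ`: `U ζ U⁻¹` is the operator defined by them, with its domain
      (∀ x : H, x ∈ ζ.domain ↔ U x ∈ (QNormal.model (QNormal.ker ζ) q A).domain) ∧
      (∀ (x : ζ.domain) (hx : U x ∈ (QNormal.model (QNormal.ker ζ) q A).domain),
        U (ζ x) = QNormal.model (QNormal.ker ζ) q A ⟨U x, hx⟩) := by
  have hd := hζ.dense_domain
  obtain ⟨R, S, B, B', hP⟩ := QNormal.exists_isGraphProjection hd hζ.isClosed
  obtain ⟨W, hM, hWC, hWk⟩ := hP.exists_polar hζ hq0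
  obtain ⟨A, hA, hsp, hev, hAz⟩ := hM.exists_modulus hq0
  have hK : ∀ x, x ∈ QNormal.ker ζ ↔ QNormal.sqrtMul R x = 0 := fun x => by
    rw [hP.mem_ker_iff_B hd, ← hWC, map_eq_zero_iff W W.injective]
  obtain ⟨U, hUk, hUW⟩ := QNormal.exists_decomposition hM hq0 hq1 hK
    (fun x hx => (hP.mem_ker_iff_R hd).1 hx) hWk
  have hrep : ∀ (n : ℤ) (h : QNormal.wandering R W), ∃ x, R x = U.symm (QNormal.single _ n h) ∧
      B x = (q : ℂ) ^ n • U.symm (QNormal.single _ (n - 1) (A h)) := by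
    intro n h
    obtain ⟨z, hz1, hz2⟩ := hAz h
    obtain ⟨x, hx1, hx2⟩ := hM.exists_zpow hq0 (-n) z
    refine ⟨x, by rw [hx1, hUW, hz1], ?_⟩
    have e := QNormal.zpow_apply_zpow W 1 (-n) (A h)
    rw [zpow_one] at e
    rw [← hWC, hx2, map_smul, neg_neg, hUW, hz2, e]
    congr 3
    ring
  have hUs : ∀ (n : ℤ) (h : QNormal.wandering R W), (U.symm (QNormal.single _ n h),
      (q : ℂ) ^ n • U.symm (QNormal.single _ (n - 1) (A h))) ∈ ζ.graph := by
    intro n h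
    obtain ⟨x, hx1, hx2⟩ := hrep n h
    rw [← hx1, ← hx2]
    exact hP.R_mem x
  have hUd : ∀ (n : ℤ) (h : QNormal.wandering R W),
      ∃ w, (U.symm (QNormal.single _ n h), w) ∈ ζ.adjoint.graph := by
    intro n h
    obtain ⟨x, hx1, -⟩ := hrep n h
    -- The equality of domains in `q`-normality enters here: the range of `R` lies in `dom ζ*ζ = dom
    -- ζζ*`, hence in `dom ζ*`.
    obtain ⟨w, hw, -⟩ := hζ.exists_mem_graph (hP.R_mem x) (hP.B_mem x)
    exact ⟨w, hx1 ▸ hw⟩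
  have hUa := QNormal.mem_adjoint_graph_single hζ hA hUk hUs hUd
  have hfwd := fun {x y : H} => QNormal.apply_eq_shift (x := x) (y := y) hζ hq0.ne' hA hUk hUa
  refine ⟨QNormal.wandering R W, inferInstance, inferInstance, inferInstance, A, U, ?_, hA, hsp,
    ?_, hUk, ?_, ?_, ?_⟩
  · by_contra hnt
    rw [not_nontrivial_iff_subsingleton] at hnt
    refine hne (QNormal.eq_zero_of_ker_eq_top fun x => ?_)
    have e : U x = U ((U x).fst : H) := by
      rw [hUk]
      exact QNormal.space_ext rfl fun n => Subsingleton.elim _ _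
    rw [U.injective e]
    exact (U x).fst.2
  · intro hq
    obtain ⟨v, hv⟩ := hq.exists_hasEigenvector
    exact hv.2 (hev v hv.apply_eq_smul)
  · intro n h
    have hn := LinearPMap.mem_domain_of_mem_graph (hUs n h)
    refine ⟨hn, ?_⟩
    have e := ζ.mem_graph_snd_inj (ζ.mem_graph ⟨_, hn⟩) (hUs n h) rfl
    rw [e, map_smul, U.apply_symm_apply]
  · intro x
    constructor
    · intro hx
      have h1 := (hfwd (ζ.mem_graph ⟨x, hx⟩)).2
      have h2 : (U (ζ ⟨x, hx⟩)).snd = QNormal.shift q A (U x) := funext h1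
      change Memℓp (QNormal.shift q A (U x)) 2
      rw [← h2]
      exact lp.memℓp _
    · intro hx
      exact LinearPMap.mem_domain_of_mem_graph
        (QNormal.mem_graph_of_shift_eq hζ.isClosed hUk hUs (v := ⟨_, hx⟩) fun _ => rfl)
  · intro x hx
    obtain ⟨h1, h2⟩ := hfwd (ζ.mem_graph x)
    exact QNormal.space_ext h1 h2
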